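/- Let $M=(\mathcal S,\mathcal A,\mathcal P,R,\gamma)$ be a discounted Markov decision process with finite state space $\mathcal S$ and finite action space $\mathcal A$, transition probabilities $\mathcal P(s'\mid s,a)$, rewards $R(s,a)\in[0,1]$ and discount factor $\gamma\in[0,1)$, and let $\mu$ be a probability distribution on $\mathcal S$. Let $\mathcal X=\Delta(\mathcal A)^{|\mathcal S|}$ be the set of stationary randomized policies $\pi=(\pi_{sa})$, and let $V_\mu(\pi)=-\mathbb E\big[\sum_{h\ge 0}\gamma^h R(s_h,a_h)\big]$, where $s_0\sim\mu$, $a_h\sim\pi_{s_h}$, $s_{h+1}\sim\mathcal P(\cdot\mid s_h,a_h)$; put $V_\mu^*=\min_{\mathcal X}V_\mu$, and let $\nabla V_\mu(\pi)$ be the matrix of partial derivatives of $V_\mu$, viewed as a power series in the entries $\pi_{sa}$. Let $\omega(\pi)=\sum_{s,a}\pi_{sa}\log\pi_{sa}$ be the matrix Shannon entropy, $D_\omega(y,x)=\omega(y)-\omega(x)-\langle\nabla\omega(x),y-x\rangle$ its Bregman divergence, and for $\rho\ge 0$ and $x\in\mathcal X$ with positive entries put $$\mathcal D_\rho(x)=-2\rho\min_{y\in\mathcal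 X}\big\{\langle\nabla V_\mu(x),y-x\rangle+\rho D_\omega(y,x)\big\}.$$ Suppose that a stochastic oracle returns, at each $\pi\in\mathcal X$, a random matrix $\widehat\nabla V_\mu(\pi)=g(\pi,\xi)$, $\xi\sim Q$, with $\mathbb E[g(\pi,\xi)]=\nabla V_\mu(\pi)$ and $\mathbb E\|g(\pi,\xi)-\nabla V_\mu(\pi)\|_{2,\infty}^2\le\sigma_{2,\infty}^2$, where $\|G\|_{2,\infty}^2=\sum_s(\max_a|G_{sa}|)^2$. Stochastic mirror policy gradient (SMPG) with step size $\eta$ starts at a policy $\pi_0\in\mathcal X$ with positive entries and iterates $$\pi_{t+1}=\arg\min_{y\in\mathcal X}\big\{\eta\langle g(\pi_t,\xi_t),y\rangle+D_\omega(y,\pi_t)\big\},\qquad \xi_0,\xi_1,\dots\ \text{i.i.d. with law } Q .$$ Put $\ell=2\gamma(1-\gamma)^{-3}$ and $$\lambda_0=\Big(\min_{y\in\mathcal X}\{V_\mu(y)+2\ell D_\omega(y,\pi_0)\}-V_\mu^*\Big)+\big(V_\mu(\pi_0)-V_\mu^*\big).$$ There is an absolute constant $C>0$ (independent of $\mathcal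 S$, $\mathcal A$, $\gamma$, $\sigma_{2,\infty}$, $\varepsilon$ and of all other data) such that for every $\varepsilon>0$ and every integer $$T\ \ge\ 1\quad\text{with}\quad T\ \ge\ C\,\lambda_0\Big(\frac{1}{(1-\gamma)^{3}\varepsilon^{2}}+\frac{\sigma_{2,\infty}^2}{(1-\gamma)^{3}\varepsilon^{4}}\Big),$$ SMPG with the constant step size $\eta=\min\big\{\frac1{2\ell},\sqrt{\lambda_0/(\sigma_{2,\infty}^2\,\ell\,T)}\big\}$ (that is, $\eta=\frac1{2\ell}$ if $\sigma_{2,\infty}=0$; for $\gamma=0$ we put $\eta=0$, the claim then being trivial because $\rho=0$) satisfies, with $\rho=6\gamma(1-\gamma)^{-3}$, $$\min_{0\le t\le T-1}\mathbb E[\mathcal D_\rho(\pi_t)]\le\varepsilon^2 ,$$ where all these expectations are finite. -/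

import Mathlib

open MeasureTheory ProbabilityTheory

noncomputable section

namespace SMPG

variable {S A : Type*} [Fintype S] [Fintype A]

/-- A finite discounted Markov decision process (without its initial distribution): transition
probabilities `P s a s'`, rewards `R s a ∈ [0, 1]` and a discount factor `γ ∈ [0, 1)`. -/
structure DMDP (S A : Type*) [Fintype S] [Fintype A] where
  P : S → A → S → ℝ
  P_nonneg : ∀ s a s', 0 ≤ P s a s'
  P_sum : ∀ s a, ∑ s', P s a s' = 1
  R : S → A → ℝ
  R_mem : ∀ s a, R s a ∈ Set.Icc (0 : ℝ) 1
  γ : ℝ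
  γ_nonneg : 0 ≤ γ
  γ_lt_one : γ < 1

/-- The set `𝒳 = Δ(A)^S` of stationary randomized policies, as row-stochastic matrices. -/
def policies (S A : Type*) [Fintype A] : Set (S → A → ℝ) :=
  {π | ∀ s, π s ∈ stdSimplex ℝ A}

/-- The zone `𝒮` of the entropy: matrices with positive entries. -/
def zone (S A : Type*) : Set (S → A → ℝ) :=
  {π | ∀ s a, 0 < π s a}

/-- The pairing `⟨G, y⟩ = ∑ₛ ∑ₐ G s a * y s a` of matrices. -/
def pairing (G y : S → A → ℝ) : ℝ := ∑ s, ∑ a, G s a * y s a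

/-- The squared `(2, ∞)`-norm `∑ₛ (maxₐ |G s a|)²`. -/
def sqNormTwoInf (G : S → A → ℝ) : ℝ := ∑ s, (⨆ a, |G s a|) ^ 2

/-- The distribution of the state `s_h` when `s_0 ∼ μ`, `a_h ∼ π (s_h)`,
`s_{h+1} ∼ P (s_h, a_h)`. It is polynomial in `π`, hence makes sense for every matrix `π`. -/
def stateDist (M : DMDP S A) (μ : S → ℝ) (π : S → A → ℝ) : ℕ → S → ℝ
  | 0 => μ
  | h + 1 => fun s' => ∑ s, ∑ a, stateDist M μ π h s * π s a * M.P s a s'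

/-- The expected discounted return `V⁺_μ(π) = ∑ₕ γʰ 𝔼[R (s_h, a_h)]`, see
`integral_return_eq`. As a power series in the entries of `π` it is defined (and smooth) on a
neighbourhood of the set of policies. -/
def expectedReturn (M : DMDP S A) (μ : S → ℝ) (π : S → A → ℝ) : ℝ :=
  ∑' h : ℕ, M.γ ^ h * ∑ s, ∑ a, stateDist M μ π h s * π s a * M.R s a

/-- The objective to be minimized, `V_μ = - V⁺_μ`. -/
def V (M : DMDP S A) (μ : S → ℝ) (π : S → A → ℝ) : ℝ := - expectedReturn M μ π

/-- The policy gradient `∇V_μ(π)`: the matrix of partial derivatives `∂V_μ / ∂π(s, a)`. -/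
def gradV [DecidableEq S] [DecidableEq A] (M : DMDP S A) (μ : S → ℝ) (π : S → A → ℝ) :
    S → A → ℝ :=
  fun s a => fderiv ℝ (V M μ) π (Pi.single s (Pi.single a 1))

/-- The minimal value of `V_μ` over all policies. -/
def optV (M : DMDP S A) (μ : S → ℝ) : ℝ := sInf (V M μ '' policies S A)

/-- The matrix Shannon entropy `ω(π) = ∑ₛ ∑ₐ π s a * log (π s a)`, with `0 * log 0 = 0`. -/
def entropy (π : S → A → ℝ) : ℝ := ∑ s, ∑ a, π s a * Real.log (π s a)

/-- The Bregman divergence `D_ω(x, y)` of the entropy (used for `y` in the zone). -/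
def bregman (x y : S → A → ℝ) : ℝ :=
  entropy x - entropy y - fderiv ℝ (entropy (S := S) (A := A)) y (x - y)

/-- The Bregman Moreau envelope `min_{y ∈ 𝒳} [V_μ(y) + ρ D_ω(y, x)]`. -/
def moreauEnv (M : DMDP S A) (μ : S → ℝ) (ρ : ℝ) (x : S → A → ℝ) : ℝ :=
  sInf ((fun y => V M μ y + ρ * bregman y x) '' policies S A)

/-- The Bregman forward-backward envelope
`𝒟_ρ(x) = - 2 ρ min_{y ∈ 𝒳} [⟨∇V_μ(x), y - x⟩ + ρ D_ω(y, x)]`. -/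
def bfbe [DecidableEq S] [DecidableEq A] (M : DMDP S A) (μ : S → ℝ) (ρ : ℝ)
    (x : S → A → ℝ) : ℝ :=
  - 2 * ρ *
    sInf ((fun y => pairing (gradV M μ x) (y - x) + ρ * bregman y x) '' policies S A)

/-- One mirror step: `x'` is a minimizer over `y ∈ 𝒳` of `η ⟨G, y⟩ + D_ω(y, x)`. -/
def IsMirrorStep (η : ℝ) (G x x' : S → A → ℝ) : Prop :=
  x' ∈ policies S A ∧ IsMinOn (fun y => η * pairing G y + bregman y x) (policies S A) x'

/-- `g` is a stochastic oracle for `∇V_μ`: at every policy `π`, with `ξ ∼ Q`, the random matrix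
`g π ξ` has mean `∇V_μ(π)` and variance at most `σ²` in the `(2, ∞)`-norm. -/
structure IsOracle [DecidableEq S] [DecidableEq A] (M : DMDP S A) (μ : S → ℝ) (σ : ℝ)
    {Ξ : Type*} [MeasurableSpace Ξ] (Q : Measure Ξ) (g : (S → A → ℝ) → Ξ → S → A → ℝ) :
    Prop where
  measurable : Measurable fun p : (S → A → ℝ) × Ξ => g p.1 p.2
  integrable : ∀ π ∈ policies S A, ∀ s a, Integrable (fun ξ => g π ξ s a) Q
  unbiased : ∀ π ∈ policies S A, ∀ s a, ∫ ξ, g π ξ s a ∂Q = gradV M μ π s a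
  integrable_sq : ∀ π ∈ policies S A,
    Integrable (fun ξ => sqNormTwoInf (g π ξ - gradV M μ π)) Q
  variance_le : ∀ π ∈ policies S A,
    ∫ ξ, sqNormTwoInf (g π ξ - gradV M μ π) ∂Q ≤ σ ^ 2

/-- `x` is a run of stochastic mirror policy gradient from `π₀` with step size `η`: `ξ 0, ξ 1, …`
are independent with law `Q`, and `x (t + 1)` is the mirror step from `x t` along
`g (x t) (ξ t)`. -/
structure IsRun {Ξ Ω : Type*} [MeasurableSpace Ξ] [MeasurableSpace Ω] (Q : Measure Ξ)
    (g : (S → A → ℝ) → Ξ → S → A → ℝ) (η : ℝ) (π₀ : S → A → ℝ) (Pr : Measure Ω)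
    (ξ : ℕ → Ω → Ξ) (x : ℕ → Ω → S → A → ℝ) : Prop where
  measurable : ∀ t, Measurable (ξ t)
  law : ∀ t, Pr.map (ξ t) = Q
  indep : iIndepFun ξ Pr
  init : ∀ ω, x 0 ω = π₀
  step : ∀ t ω, IsMirrorStep η (g (x t ω) (ξ t ω)) (x t ω) (x (t + 1) ω)

/-- The smoothness constant `ℓ = 2 γ (1 - γ)⁻³`. -/
def smoothConst (M : DMDP S A) : ℝ := 2 * M.γ / (1 - M.γ) ^ 3

/-- The initial gap `λ₀ = Φ_{1/(2ℓ)}(π₀) - Φ* + Φ(π₀) - Φ*` for `Φ = V_μ`. -/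
def initGap (M : DMDP S A) (μ : S → ℝ) (π₀ : S → A → ℝ) : ℝ :=
  (moreauEnv M μ (2 * smoothConst M) π₀ - optV M μ) + (V M μ π₀ - optV M μ)

/-- The constant step size `min {1 / (2ℓ), √(l₀ / (σ² ℓ T))}`; the second term is read as `+∞`
if `σ = 0`. -/
def stepSize (ℓ l₀ σ : ℝ) (T : ℕ) : ℝ :=
  if σ = 0 then 1 / (2 * ℓ) else min (1 / (2 * ℓ)) (Real.sqrt (l₀ / (σ ^ 2 * ℓ * T)))

/-- `expectedReturn` is the expected discounted sum of rewards `𝔼[∑ₕ γʰ R (s_h, a_h)]` of every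
process with `s_0 ∼ μ`, `a_h ∼ π (s_h)` and `s_{h+1} ∼ P (s_h, a_h)`. -/
theorem integral_return_eq [MeasurableSpace S] [MeasurableSingletonClass S]
    [MeasurableSpace A] [MeasurableSingletonClass A]
    (M : DMDP S A) (μ : S → ℝ) (π : S → A → ℝ)
    {Ω : Type*} [MeasurableSpace Ω] (Pr : Measure Ω) [IsProbabilityMeasure Pr]
    (s : ℕ → Ω → S) (a : ℕ → Ω → A) (hs : ∀ h, Measurable (s h)) (ha : ∀ h, Measurable (a h))
    (h0 : ∀ i, Pr.real {ω | s 0 ω = i} = μ i)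
    (hact : ∀ h i b, Pr.real {ω | s h ω = i ∧ a h ω = b} = Pr.real {ω | s h ω = i} * π i b)
    (hnext : ∀ h i b j, Pr.real {ω | (s h ω = i ∧ a h ω = b) ∧ s (h + 1) ω = j}
      = Pr.real {ω | s h ω = i ∧ a h ω = b} * M.P i b j) :
    ∫ ω, ∑' h : ℕ, M.γ ^ h * M.R (s h ω) (a h ω) ∂Pr = expectedReturn M μ π := by
  have hsm : ∀ h i, MeasurableSet {ω | s h ω = i} := fun h i => hs h (measurableSet_singleton i)
  have ham : ∀ h b, MeasurableSet {ω | a h ω = b} := fun h b => ha h (measurableSet_singleton b)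
  have hm : ∀ h i b, MeasurableSet {ω | s h ω = i ∧ a h ω = b} := fun h i b =>
    (hsm h i).inter (ham h b)
  have key : ∀ (h : ℕ) (c : S → A → ℝ) (E : Set Ω), MeasurableSet E →
      ∫ ω, c (s h ω) (a h ω) * E.indicator 1 ω ∂Pr
        = ∑ i, ∑ b, Pr.real ({ω | s h ω = i ∧ a h ω = b} ∩ E) * c i b := by
    intro h c E hE
    classical
    have : (fun ω => c (s h ω) (a h ω) * E.indicator (1 : Ω → ℝ) ω) = fun ω => ∑ i, ∑ b,
        ({ω | s h ω = i ∧ a h ω = b} ∩ E).indicator (fun _ => c i b) ω := by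
      funext ω
      rw [Finset.sum_eq_single (s h ω), Finset.sum_eq_single (a h ω)]
      · by_cases hω : ω ∈ E <;> simp [Set.indicator, hω]
      · intro b _ hb
        simp [Set.indicator, Ne.symm hb]
      · simp
      · intro i _ hi
        simp [Set.indicator, Ne.symm hi]
      · simp
    rw [this, integral_finsetSum _ fun i _ => integrable_finsetSum _ fun b _ =>
      (integrable_const (c i b)).indicator ((hm h i b).inter hE)]
    refine Finset.sum_congr rfl fun i _ => ?_
    rw [integral_finsetSum _ fun b _ =>
      (integrable_const (c i b)).indicator ((hm h i b).inter hE)]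
    refine Finset.sum_congr rfl fun b _ => ?_
    rw [integral_indicator_const _ ((hm h i b).inter hE), smul_eq_mul]
  have hdist : ∀ h i, Pr.real {ω | s h ω = i} = stateDist M μ π h i := by
    intro h
    induction h with
    | zero => exact h0
    | succ h ih =>
      intro j
      have h1 := key h (fun _ _ => 1) {ω | s (h + 1) ω = j} (hsm _ j)
      simp only [one_mul, mul_one] at h1
      rw [integral_indicator_one (hsm _ j)] at h1
      rw [h1]
      show _ = ∑ i, ∑ b, stateDist M μ π h i * π i b * M.P i b j
      refine Finset.sum_congr rfl fun i _ => Finset.sum_congr rfl fun b _ => ?_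
      rw [← ih i, ← hact h i b, ← hnext h i b j]
      rfl
  have hbd : ∀ h ω, ‖M.γ ^ h * M.R (s h ω) (a h ω)‖ ≤ M.γ ^ h := by
    intro h ω
    have hR := M.R_mem (s h ω) (a h ω)
    have hγ := pow_nonneg M.γ_nonneg h
    rw [Real.norm_of_nonneg (mul_nonneg hγ hR.1)]
    exact mul_le_of_le_one_right hγ hR.2
  have hmeas : ∀ h, Measurable fun ω => M.γ ^ h * M.R (s h ω) (a h ω) := by
    intro h
    have : Measurable fun p : S × A => M.R p.1 p.2 := measurable_of_finite _
    exact (this.comp ((hs h).prodMk (ha h))).const_mul _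
  have hint : ∀ h, Integrable (fun ω => M.γ ^ h * M.R (s h ω) (a h ω)) Pr := fun h =>
    Integrable.of_bound (hmeas h).aestronglyMeasurable _ (Filter.Eventually.of_forall (hbd h))
  rw [← integral_tsum_of_summable_integral_norm hint]
  · unfold expectedReturn
    refine tsum_congr fun h => ?_
    have h1 := key h M.R Set.univ MeasurableSet.univ
    simp only [Set.indicator_univ, Pi.one_apply, mul_one, Set.inter_univ] at h1
    rw [integral_const_mul, h1]
    simp only [hact, hdist]
  · refine Summable.of_nonneg_of_le (fun h => integral_nonneg fun ω => norm_nonneg _) (fun h => ?_)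
      (summable_geometric_of_lt_one M.γ_nonneg M.γ_lt_one)
    calc ∫ ω, ‖M.γ ^ h * M.R (s h ω) (a h ω)‖ ∂Pr ≤ ∫ _, M.γ ^ h ∂Pr :=
          integral_mono (hint h).norm (integrable_const _) (hbd h)
      _ = M.γ ^ h := by simp

end SMPG

end

/-! The proof is a descent argument for the potential `moreauEnv` at `2ℓ` plus `2ℓη V`, with `ℓ =
smoothConst M`.

Two facts drive it. First, `V` is `ℓ`-smooth relative to the entropy, from above and from below
(`relative_smoothness`). By the performance difference lemma, the first-order remainder of the
return is a change of occupancy measure paired with a change of policy. Each factor is linear in the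
`ℓ¹` change of the rows, and Pinsker's inequality turns the square into a Bregman divergence.
Second, a mirror step is a multiplicative weights update, so the three-point relation is an exact
identity (`bregman_mwUpdate`) and the iterates are explicit measurable functions of the samples.

For the descent, the proximal point `z` of the current policy `x` serves as a test point in the
envelope at the next policy `x'`. The linear term `⟨∇V(x), z - x⟩` is at most the envelope minus
`V(x)`, which is a negative multiple of `bfbe` by `bfbe_le`. The term `-⟨∇V(x), x' - x⟩` costs `V(x)
- V(x')`, which the second summand of the potential telescopes. The noise against `z - x` has mean
zero because `z` depends on `x` only. The noise against `x - x'` is split by Young's inequality into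
`η²` times the squared noise and half of `D(x', x)`, which the three-point identity pays for. No
mini-batches are needed.

Taking expectations by independence and Fubini, telescoping and balancing the two resulting terms
gives the rate. -/

namespace SMPG

/-! ### Entropy, Pinsker's inequality and the Bregman divergence. -/

section Entropy

variable {S A : Type*} [Fintype S] [Fintype A]

/-- A Padé-type lower bound of the logarithm. -/
theorem pade_le_log {t : ℝ} (ht : 0 < t) :
    (t - 1) * (5 * t + 1) / (2 * t * (t + 2)) ≤ Real.log t := by
  -- The derivative of this difference is `(t - 1)³` over a positive quantity, so its minimum is at
  -- `1`, where it vanishes.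
  let φ : ℝ → ℝ := fun t => Real.log t - (t - 1) * (5 * t + 1) / (2 * t * (t + 2))
  have hd : ∀ t : ℝ, 0 < t → HasDerivAt φ ((t - 1) ^ 3 / (t ^ 2 * (t + 2) ^ 2)) t := by
    intro t ht
    have h1 : HasDerivAt (fun t : ℝ => (t - 1) * (5 * t + 1)) (1 * (5 * t + 1) + (t - 1) * 5) t := by
      have := ((hasDerivAt_id t).sub_const 1).fun_mul (((hasDerivAt_id t).const_mul 5).add_const 1)
      simpa using this
    have h2 : HasDerivAt (fun t : ℝ => 2 * t * (t + 2)) (2 * (t + 2) + 2 * t * 1) t := by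
      have := ((hasDerivAt_id t).const_mul 2).fun_mul ((hasDerivAt_id t).add_const 2)
      simpa using this
    have h3 := (Real.hasDerivAt_log ht.ne').sub (h1.div h2 (by positivity))
    refine h3.congr_deriv ?_
    field_simp
    ring
  have h1 : φ 1 = 0 := by simp [φ]
  suffices h : φ 1 ≤ φ t by
    rw [h1] at h
    simpa [φ] using h
  rcases le_total t 1 with h | h
  · refine antitoneOn_of_hasDerivWithinAt_nonpos (convex_Icc t 1)
      (f' := fun t => (t - 1) ^ 3 / (t ^ 2 * (t + 2) ^ 2))
      (fun u hu => (hd u (ht.trans_le hu.1)).continuousAt.continuousWithinAt)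
      (fun u hu => ?_) (fun u hu => ?_) ⟨le_rfl, h⟩ ⟨h, le_rfl⟩ h
    · rw [interior_Icc] at hu
      exact (hd u (ht.trans hu.1)).hasDerivWithinAt
    · rw [interior_Icc] at hu
      have : 0 ≤ (1 - u) ^ 3 := pow_nonneg (by linarith [hu.2]) 3
      exact div_nonpos_of_nonpos_of_nonneg (by nlinarith) (by positivity)
  · refine monotoneOn_of_hasDerivWithinAt_nonneg (convex_Icc 1 t)
      (f' := fun t => (t - 1) ^ 3 / (t ^ 2 * (t + 2) ^ 2))
      (fun u hu => (hd u (one_pos.trans_le hu.1)).continuousAt.continuousWithinAt)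
      (fun u hu => ?_) (fun u hu => ?_) ⟨le_rfl, h⟩ ⟨h, le_rfl⟩ h
    · rw [interior_Icc] at hu
      exact (hd u (one_pos.trans hu.1)).hasDerivWithinAt
    · rw [interior_Icc] at hu
      have : 0 ≤ (u - 1) ^ 3 := pow_nonneg (by linarith [hu.1]) 3
      positivity

/-- This is `pade_le_log` at `a / b`, multiplied by `a`. The denominators `a + 2 * b` sum to `3`
over two probability vectors, so Cauchy–Schwarz with these weights turns the factor `3 / 2` into
Pinsker's constant `1 / 2`. -/
theorem sq_div_le_kl_term {a b : ℝ} (ha : 0 ≤ a) (hb : 0 < b) :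
    3 / 2 * ((a - b) ^ 2 / (a + 2 * b)) ≤ a * Real.log a - a * Real.log b - a + b := by
  rcases ha.eq_or_lt with rfl | ha
  · simp only [zero_mul, zero_sub, zero_add, sub_zero]
    rw [neg_sq, pow_two, mul_div_mul_right _ _ hb.ne']
    linarith
  · have h := mul_le_mul_of_nonneg_left (pade_le_log (div_pos ha hb)) ha.le
    rw [Real.log_div ha.ne' hb.ne'] at h
    have e : a * ((a / b - 1) * (5 * (a / b) + 1) / (2 * (a / b) * (a / b + 2)))
        = 3 / 2 * ((a - b) ^ 2 / (a + 2 * b)) + a - b := by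
      field_simp
      ring
    linarith

/-- Pinsker's inequality on a finite simplex. -/
theorem pinsker {y x : A → ℝ} (hy : y ∈ stdSimplex ℝ A) (hx : x ∈ stdSimplex ℝ A)
    (hpos : ∀ a, 0 < x a) :
    1 / 2 * (∑ a, |y a - x a|) ^ 2 ≤ ∑ a, (y a * Real.log (y a) - y a * Real.log (x a)) := by
  have hw : ∀ a, 0 < y a + 2 * x a := fun a => by linarith [hy.1 a, hpos a]
  have h1 := Finset.sum_le_sum fun a (_ : a ∈ Finset.univ) => sq_div_le_kl_term (hy.1 a) (hpos a)
  have h2 := Finset.sum_sq_le_sum_mul_sum_of_sq_le_mul Finset.univ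
    (r := fun a => |y a - x a|) (f := fun a => (y a - x a) ^ 2 / (y a + 2 * x a))
    (g := fun a => y a + 2 * x a)
    (fun a _ => div_nonneg (sq_nonneg _) (hw a).le) (fun a _ => (hw a).le)
    (fun a _ => by rw [sq_abs, div_mul_cancel₀ _ (hw a).ne'])
  have h3 : ∑ a, (y a + 2 * x a) = 3 := by
    rw [Finset.sum_add_distrib, ← Finset.mul_sum, hy.2, hx.2]; norm_num
  rw [h3] at h2
  rw [← Finset.mul_sum] at h1
  have h4 : ∑ a, (y a * Real.log (y a) - y a * Real.log (x a) - y a + x a)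
      = ∑ a, (y a * Real.log (y a) - y a * Real.log (x a)) := by
    rw [Finset.sum_add_distrib, Finset.sum_sub_distrib, hy.2, hx.2]; ring
  linarith

theorem pairing_sub (G y z : S → A → ℝ) : pairing G (y - z) = pairing G y - pairing G z := by
  simp [pairing, mul_sub, Finset.sum_sub_distrib]

theorem sub_pairing (G H y : S → A → ℝ) : pairing (G - H) y = pairing G y - pairing H y := by
  simp [pairing, sub_mul, Finset.sum_sub_distrib]

theorem pairing_smul (c : ℝ) (G y : S → A → ℝ) : pairing (c • G) y = c * pairing G y := by
  simp [pairing, Finset.mul_sum, mul_assoc]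

/-- The entrywise logarithm of a matrix. -/
noncomputable def logMat (x : S → A → ℝ) : S → A → ℝ := fun s a => Real.log (x s a)

theorem entropy_eq_pairing (x : S → A → ℝ) : entropy x = pairing (logMat x) x := by
  simp [entropy, pairing, logMat, mul_comm]

theorem fderiv_entropy {x : S → A → ℝ} (hx : x ∈ zone S A) (u : S → A → ℝ) :
    fderiv ℝ (entropy (S := S) (A := A)) x u = ∑ s, ∑ a, (Real.log (x s a) + 1) * u s a := by
  have h : HasFDerivAt (entropy (S := S) (A := A))
      (∑ s, ∑ a, (Real.log (x s a) + 1) •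
        ((ContinuousLinearMap.proj (R := ℝ) (φ := fun _ : A => ℝ) a).comp
          (ContinuousLinearMap.proj (R := ℝ) (φ := fun _ : S => A → ℝ) s))) x := by
    unfold entropy
    refine HasFDerivAt.fun_sum fun s _ => HasFDerivAt.fun_sum fun a _ => ?_
    have h1 := Real.hasDerivAt_mul_log (hx s a).ne'
    exact HasDerivAt.comp_hasFDerivAt x h1
      (((ContinuousLinearMap.proj (R := ℝ) (φ := fun _ : A => ℝ) a).comp
          (ContinuousLinearMap.proj (R := ℝ) (φ := fun _ : S => A → ℝ) s)).hasFDerivAt)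
  rw [h.fderiv]
  simp

/-- The derivative of `t log t` contributes a `+ 1` that disappears because the rows of `y - x` sum
to zero. What remains depends on `x` only through a pairing with `logMat x`. -/
theorem bregman_eq {x y : S → A → ℝ} (hy : y ∈ policies S A) (hx : x ∈ policies S A ∩ zone S A) :
    bregman y x = entropy y - pairing (logMat x) y := by
  unfold bregman
  rw [fderiv_entropy hx.2, entropy_eq_pairing x]
  have h : ∑ s, ∑ a, (Real.log (x s a) + 1) * (y - x) s a
      = pairing (logMat x) y - pairing (logMat x) x := by
    rw [← pairing_sub]
    unfold pairing logMat
    refine Finset.sum_congr rfl fun s _ => ?_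
    simp only [add_mul, one_mul, Finset.sum_add_distrib]
    have : ∑ a, (y - x) s a = 0 := by
      simp [Finset.sum_sub_distrib, (hy s).2, (hx.1 s).2]
    rw [this, add_zero]
  rw [h]
  ring

theorem bregman_self (x : S → A → ℝ) : bregman x x = 0 := by simp [bregman]

/-- Strong convexity of the entropy in the `(2, 1)`-norm. -/
theorem sum_sq_le_bregman {x y : S → A → ℝ} (hy : y ∈ policies S A)
    (hx : x ∈ policies S A ∩ zone S A) :
    1 / 2 * ∑ s, (∑ a, |y s a - x s a|) ^ 2 ≤ bregman y x := by
  rw [bregman_eq hy hx, entropy, pairing, ← Finset.sum_sub_distrib, Finset.mul_sum]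
  refine Finset.sum_le_sum fun s _ => (pinsker (hy s) (hx.1 s) (hx.2 s)).trans_eq ?_
  rw [← Finset.sum_sub_distrib]
  simp [logMat, mul_comm]

theorem bregman_nonneg {x y : S → A → ℝ} (hy : y ∈ policies S A)
    (hx : x ∈ policies S A ∩ zone S A) : 0 ≤ bregman y x :=
  (by positivity : (0 : ℝ) ≤ 1 / 2 * ∑ s, (∑ a, |y s a - x s a|) ^ 2).trans
    (sum_sq_le_bregman hy hx)

theorem eq_of_bregman_nonpos {x y : S → A → ℝ} (hy : y ∈ policies S A)
    (hx : x ∈ policies S A ∩ zone S A) (h : bregman y x ≤ 0) : y = x := by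
  have h1 := (sum_sq_le_bregman hy hx).trans h
  have h2 : ∑ s, (∑ a, |y s a - x s a|) ^ 2 = 0 :=
    le_antisymm (by linarith) (Finset.sum_nonneg fun _ _ => sq_nonneg _)
  funext s a
  have h3 := (Finset.sum_eq_zero_iff_of_nonneg fun _ _ => sq_nonneg _).1 h2 s (Finset.mem_univ s)
  have h4 := (Finset.sum_eq_zero_iff_of_nonneg fun _ _ => abs_nonneg _).1
    (pow_eq_zero_iff two_ne_zero |>.1 h3) a (Finset.mem_univ a)
  exact sub_eq_zero.1 (abs_eq_zero.1 h4)

/-! ### Mirror steps as multiplicative weights updates. -/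

/-- The multiplicative weights update `x s a * exp (- η * G s a) / Z s`. -/
noncomputable def mwUpdate (η : ℝ) (G x : S → A → ℝ) : S → A → ℝ :=
  fun s a => x s a * Real.exp (-(η * G s a)) / ∑ b, x s b * Real.exp (-(η * G s b))

omit [Fintype S] in
theorem partition_pos {x : S → A → ℝ} (hx : x ∈ policies S A ∩ zone S A) (η : ℝ)
    (G : S → A → ℝ) (s : S) : 0 < ∑ b, x s b * Real.exp (-(η * G s b)) := by
  have hA : (Finset.univ : Finset A).Nonempty := by
    by_contra h
    have := (hx.1 s).2
    rw [Finset.not_nonempty_iff_eq_empty.1 h, Finset.sum_empty] at this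
    exact zero_ne_one this
  exact Finset.sum_pos (fun b _ => mul_pos (hx.2 s b) (Real.exp_pos _)) hA

theorem mwUpdate_mem {x : S → A → ℝ} (hx : x ∈ policies S A ∩ zone S A) (η : ℝ)
    (G : S → A → ℝ) : mwUpdate η G x ∈ policies S A ∩ zone S A := by
  have hpos : mwUpdate η G x ∈ zone S A := fun s a =>
    div_pos (mul_pos (hx.2 s a) (Real.exp_pos _)) (partition_pos hx η G s)
  refine ⟨fun s => ⟨fun a => (hpos s a).le, ?_⟩, hpos⟩
  unfold mwUpdate
  rw [← Finset.sum_div, div_self (partition_pos hx η G s).ne']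

/-- The logarithm of the update is `log x - η G` minus the log-partition function of each row, and
rows of `y` have total mass one. So minimizing the mirror objective amounts to minimizing the
divergence to the update, whose only zero is the update itself. -/
theorem mirror_objective_eq {x y : S → A → ℝ} (hy : y ∈ policies S A)
    (hx : x ∈ policies S A ∩ zone S A) (η : ℝ) (G : S → A → ℝ) :
    η * pairing G y + bregman y x = bregman y (mwUpdate η G x)
      - ∑ s, Real.log (∑ b, x s b * Real.exp (-(η * G s b))) := by
  rw [bregman_eq hy hx, bregman_eq hy (mwUpdate_mem hx η G)]
  have h : pairing (logMat (mwUpdate η G x)) y = pairing (logMat x) y - η * pairing G y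
      - ∑ s, Real.log (∑ b, x s b * Real.exp (-(η * G s b))) := by
    unfold pairing
    rw [Finset.mul_sum, ← Finset.sum_sub_distrib, ← Finset.sum_sub_distrib]
    refine Finset.sum_congr rfl fun s _ => ?_
    have h1 : Real.log (∑ b, x s b * Real.exp (-(η * G s b)))
        = ∑ a, Real.log (∑ b, x s b * Real.exp (-(η * G s b))) * y s a := by
      rw [← Finset.mul_sum, (hy s).2, mul_one]
    rw [h1, Finset.mul_sum, ← Finset.sum_sub_distrib, ← Finset.sum_sub_distrib]
    refine Finset.sum_congr rfl fun a _ => ?_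
    unfold logMat mwUpdate
    rw [Real.log_div (mul_pos (hx.2 s a) (Real.exp_pos _)).ne' (partition_pos hx η G s).ne',
      Real.log_mul (hx.2 s a).ne' (Real.exp_pos _).ne', Real.log_exp]
    ring
  linarith

theorem IsMirrorStep.eq_mwUpdate {η : ℝ} {G x x' : S → A → ℝ} (h : IsMirrorStep η G x x')
    (hx : x ∈ policies S A ∩ zone S A) : x' = mwUpdate η G x := by
  have hm := mwUpdate_mem hx η G
  have h1 : η * pairing G x' + bregman x' x
      ≤ η * pairing G (mwUpdate η G x) + bregman (mwUpdate η G x) x := h.2 hm.1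
  rw [mirror_objective_eq h.1 hx, mirror_objective_eq hm.1 hx, bregman_self] at h1
  exact eq_of_bregman_nonpos h.1 hm (by linarith)

/-- The three-point identity, obtained by subtracting `mirror_objective_eq` at the update from the
same identity at `y`; the log-partition constants cancel. -/
theorem bregman_mwUpdate {x y : S → A → ℝ} (hy : y ∈ policies S A)
    (hx : x ∈ policies S A ∩ zone S A) (η : ℝ) (G : S → A → ℝ) :
    bregman y (mwUpdate η G x) = bregman y x - bregman (mwUpdate η G x) x
      + η * pairing G (y - mwUpdate η G x) := by
  have h1 := mirror_objective_eq hy hx η G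
  have h2 := mirror_objective_eq (mwUpdate_mem hx η G).1 hx η G
  rw [bregman_self] at h2
  rw [pairing_sub]
  linarith

theorem continuous_entropy : Continuous (entropy (S := S) (A := A)) := by
  unfold entropy
  refine continuous_finsetSum _ fun s _ => continuous_finsetSum _ fun a _ => ?_
  exact Real.continuous_mul_log.comp (by fun_prop)

theorem continuous_pairing {X : Type*} [TopologicalSpace X] {f h : X → S → A → ℝ}
    (hf : Continuous f) (hh : Continuous h) : Continuous fun p => pairing (f p) (h p) := by
  unfold pairing
  fun_prop

omit [Fintype S] in
theorem isCompact_policies : IsCompact (policies S A) := by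
  have : policies S A = Set.univ.pi fun _ : S => stdSimplex ℝ A := by
    ext π; simp [policies]
  rw [this]
  exact isCompact_univ_pi fun _ => isCompact_stdSimplex ℝ A

/-- Hölder and Young for the `(2, ∞)` and `(2, 1)` norms. -/
theorem pairing_le_young (η : ℝ) (e u : S → A → ℝ) :
    η * pairing e u ≤ η ^ 2 * sqNormTwoInf e + 1 / 4 * ∑ s, (∑ a, |u s a|) ^ 2 := by
  unfold pairing sqNormTwoInf
  rw [Finset.mul_sum, Finset.mul_sum, Finset.mul_sum, ← Finset.sum_add_distrib]
  refine Finset.sum_le_sum fun s _ => ?_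
  have h : |∑ a, e s a * u s a| ≤ (⨆ a, |e s a|) * ∑ a, |u s a| := by
    rw [Finset.mul_sum]
    refine (Finset.abs_sum_le_sum_abs _ _).trans (Finset.sum_le_sum fun a _ => ?_)
    rw [abs_mul]
    exact mul_le_mul_of_nonneg_right
      (le_ciSup (f := fun a => |e s a|) (Set.finite_range _).bddAbove a) (abs_nonneg _)
  calc η * ∑ a, e s a * u s a ≤ |η| * ((⨆ a, |e s a|) * ∑ a, |u s a|) := by
        refine (le_abs_self _).trans ?_
        rw [abs_mul]
        exact mul_le_mul_of_nonneg_left h (abs_nonneg _)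
    _ ≤ _ := by
        -- Completing the square; the weight `1 / 4` is chosen so that Pinsker bounds the last term
        -- by half a Bregman divergence.
        nlinarith [sq_nonneg (|η| * (⨆ a, |e s a|) - 1 / 2 * ∑ a, |u s a|), sq_abs η]

end Entropy

/-! ### Occupancy measures and their dependence on the policy. -/

section Smoothness

variable {S A : Type*} [Fintype S] [Fintype A] (M : DMDP S A) {μ : S → ℝ}

/-- The unnormalized discounted occupancy measure `∑ₕ γʰ ℙ(s_h = s)`. -/
noncomputable def occupancy (μ : S → ℝ) (y : S → A → ℝ) (s : S) : ℝ :=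
  ∑' h : ℕ, M.γ ^ h * stateDist M μ y h s

/-- The `ℓ¹` norm contracts under a stochastic kernel. -/
theorem sum_abs_kernel_le (c : S → A → ℝ) :
    ∑ s', |∑ s, ∑ a, c s a * M.P s a s'| ≤ ∑ s, ∑ a, |c s a| := by
  calc ∑ s', |∑ s, ∑ a, c s a * M.P s a s'|
      ≤ ∑ s', ∑ s, ∑ a, |c s a| * M.P s a s' := by
        refine Finset.sum_le_sum fun s' _ => (Finset.abs_sum_le_sum_abs _ _).trans
          (Finset.sum_le_sum fun s _ => (Finset.abs_sum_le_sum_abs _ _).trans_eq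
            (Finset.sum_congr rfl fun a _ => ?_))
        rw [abs_mul, abs_of_nonneg (M.P_nonneg s a s')]
    _ = ∑ s, ∑ a, |c s a| := by
        rw [Finset.sum_comm]
        refine Finset.sum_congr rfl fun s _ => ?_
        rw [Finset.sum_comm]
        refine Finset.sum_congr rfl fun a _ => ?_
        rw [← Finset.mul_sum, M.P_sum, mul_one]

theorem sum_abs_mul_le (d : S → ℝ) {y : S → A → ℝ} {κ : ℝ} (hy : ∀ s, ∑ a, |y s a| ≤ κ) :
    ∑ s, ∑ a, |d s * y s a| ≤ (∑ s, |d s|) * κ := by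
  rw [Finset.sum_mul]
  refine Finset.sum_le_sum fun s _ => ?_
  simp only [abs_mul, ← Finset.mul_sum]
  exact mul_le_mul_of_nonneg_left (hy s) (abs_nonneg _)

theorem sum_abs_stateDist_le (hμ : μ ∈ stdSimplex ℝ S) {y : S → A → ℝ} {κ : ℝ} (hκ : 0 ≤ κ)
    (hy : ∀ s, ∑ a, |y s a| ≤ κ) (h : ℕ) : ∑ s, |stateDist M μ y h s| ≤ κ ^ h := by
  induction h with
  | zero =>
    rw [pow_zero, ← hμ.2]
    exact (Finset.sum_congr rfl fun s _ => abs_of_nonneg (hμ.1 s)).le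
  | succ h ih =>
    refine (sum_abs_kernel_le M fun s a => stateDist M μ y h s * y s a).trans
      ((sum_abs_mul_le _ hy).trans ?_)
    rw [pow_succ]
    exact mul_le_mul_of_nonneg_right ih hκ

theorem abs_discounted_stateDist_le (hμ : μ ∈ stdSimplex ℝ S) {y : S → A → ℝ} {κ : ℝ}
    (hκ : 0 ≤ κ) (hy : ∀ s, ∑ a, |y s a| ≤ κ) (h : ℕ) :
    ∑ s, |M.γ ^ h * stateDist M μ y h s| ≤ (M.γ * κ) ^ h := by
  simp only [abs_mul, ← Finset.mul_sum, abs_of_nonneg (pow_nonneg M.γ_nonneg h), mul_pow]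
  exact mul_le_mul_of_nonneg_left (sum_abs_stateDist_le M hμ hκ hy h) (pow_nonneg M.γ_nonneg h)

theorem summable_abs_discounted (hμ : μ ∈ stdSimplex ℝ S) {y : S → A → ℝ} {κ : ℝ} (hκ : 0 ≤ κ)
    (hq : M.γ * κ < 1) (hy : ∀ s, ∑ a, |y s a| ≤ κ) (s : S) :
    Summable fun h => |M.γ ^ h * stateDist M μ y h s| :=
  Summable.of_nonneg_of_le (fun _ => abs_nonneg _)
    (fun h => (Finset.single_le_sum (f := fun s => |M.γ ^ h * stateDist M μ y h s|)
      (fun _ _ => abs_nonneg _) (Finset.mem_univ s)).trans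
        (abs_discounted_stateDist_le M hμ hκ hy h))
    (summable_geometric_of_lt_one (mul_nonneg M.γ_nonneg hκ) hq)

theorem sum_abs_occupancy_le (hμ : μ ∈ stdSimplex ℝ S) {y : S → A → ℝ} {κ : ℝ} (hκ : 0 ≤ κ)
    (hq : M.γ * κ < 1) (hy : ∀ s, ∑ a, |y s a| ≤ κ) :
    ∑ s, |occupancy M μ y s| ≤ (1 - M.γ * κ)⁻¹ := by
  have hs := summable_abs_discounted M hμ hκ hq hy
  rw [← tsum_geometric_of_lt_one (mul_nonneg M.γ_nonneg hκ) hq]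
  calc ∑ s, |occupancy M μ y s| ≤ ∑ s, ∑' h, |M.γ ^ h * stateDist M μ y h s| :=
        Finset.sum_le_sum fun s _ => by
          simpa only [Real.norm_eq_abs, occupancy] using
            norm_tsum_le_tsum_norm (f := fun h => M.γ ^ h * stateDist M μ y h s) (hs s)
    _ = ∑' h, ∑ s, |M.γ ^ h * stateDist M μ y h s| :=
        (Summable.tsum_finsetSum fun s _ => hs s).symm
    _ ≤ _ := (summable_sum fun s _ => hs s).tsum_le_tsum
        (abs_discounted_stateDist_le M hμ hκ hy)
        (summable_geometric_of_lt_one (mul_nonneg M.γ_nonneg hκ) hq)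

/-- The flow equation of the discounted chain: split off time zero and shift the series. It is
stated for matrices whose rows have `ℓ¹` norm at most `κ` with `γκ < 1`, since differentiating at a
policy requires leaving the simplex. -/
theorem occupancy_eq (hμ : μ ∈ stdSimplex ℝ S) {y : S → A → ℝ} {κ : ℝ} (hκ : 0 ≤ κ)
    (hq : M.γ * κ < 1) (hy : ∀ s, ∑ a, |y s a| ≤ κ) (s' : S) :
    occupancy M μ y s' = μ s' + M.γ * ∑ s, ∑ a, occupancy M μ y s * y s a * M.P s a s' := by
  have hs := fun s => (summable_abs_discounted M hμ hκ hq hy s).of_abs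
  unfold occupancy
  rw [(hs s').tsum_eq_zero_add]
  congr 1
  · simp [stateDist]
  · have h1 : ∀ h, M.γ ^ (h + 1) * stateDist M μ y (h + 1) s' = M.γ * ∑ s, ∑ a,
        M.γ ^ h * stateDist M μ y h s * (y s a * M.P s a s') := by
      intro h
      simp only [stateDist, Finset.mul_sum]
      exact Finset.sum_congr rfl fun s _ => Finset.sum_congr rfl fun a _ => by ring
    simp only [h1, mul_assoc _ (y _ _)]
    rw [tsum_mul_left, Summable.tsum_finsetSum
      fun s _ => summable_sum fun a _ => (hs s).mul_right _]
    congr 1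
    refine Finset.sum_congr rfl fun s _ => ?_
    rw [Summable.tsum_finsetSum fun a _ => (hs s).mul_right _]
    exact Finset.sum_congr rfl fun a _ => tsum_mul_right

theorem expectedReturn_eq (hμ : μ ∈ stdSimplex ℝ S) {y : S → A → ℝ} {κ : ℝ} (hκ : 0 ≤ κ)
    (hq : M.γ * κ < 1) (hy : ∀ s, ∑ a, |y s a| ≤ κ) :
    expectedReturn M μ y = ∑ s, ∑ a, occupancy M μ y s * (y s a * M.R s a) := by
  have hs := fun s => (summable_abs_discounted M hμ hκ hq hy s).of_abs
  have h1 : ∀ h, M.γ ^ h * ∑ s, ∑ a, stateDist M μ y h s * y s a * M.R s a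
      = ∑ s, ∑ a, M.γ ^ h * stateDist M μ y h s * (y s a * M.R s a) := by
    intro h
    simp only [Finset.mul_sum]
    exact Finset.sum_congr rfl fun s _ => Finset.sum_congr rfl fun a _ => by ring
  unfold expectedReturn occupancy
  simp only [h1]
  rw [Summable.tsum_finsetSum fun s _ => summable_sum fun a _ => (hs s).mul_right _]
  refine Finset.sum_congr rfl fun s _ => ?_
  rw [Summable.tsum_finsetSum fun a _ => (hs s).mul_right _]
  exact Finset.sum_congr rfl fun a _ => tsum_mul_right

omit [Fintype S] in
theorem sum_abs_policy {x : S → A → ℝ} (hx : x ∈ policies S A) (s : S) : ∑ a, |x s a| ≤ 1 :=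
  ((Finset.sum_congr rfl fun a _ => abs_of_nonneg ((hx s).1 a)).trans (hx s).2).le

/-- Subtracting the flow equations gives a source term `γ P (d_y (y - x))` and a term `γ P ((d_y -
d_x) x)`. The latter has norm at most `γ` times the left side and is absorbed, which produces the
factor `1 / (1 - γ)`. -/
theorem sum_abs_occupancy_sub_le (hμ : μ ∈ stdSimplex ℝ S) {x y : S → A → ℝ} {κ δ : ℝ}
    (hκ : 0 ≤ κ) (hδ : 0 ≤ δ) (hq : M.γ * κ < 1) (hx : x ∈ policies S A)
    (hy : ∀ s, ∑ a, |y s a| ≤ κ) (hyx : ∀ s, ∑ a, |y s a - x s a| ≤ δ) :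
    ∑ s, |occupancy M μ y s - occupancy M μ x s|
      ≤ M.γ * δ / ((1 - M.γ * κ) * (1 - M.γ)) := by
  have h1 : (0 : ℝ) < 1 - M.γ := by linarith [M.γ_lt_one]
  have h2 : (0 : ℝ) < 1 - M.γ * κ := by linarith
  have hx' : ∀ s, ∑ a, |x s a| ≤ 1 := sum_abs_policy hx
  set dy := occupancy M μ y
  set dx := occupancy M μ x
  have e : ∀ s', dy s' - dx s' = M.γ * (∑ s, ∑ a, dy s * (y s a - x s a) * M.P s a s'
      + ∑ s, ∑ a, (dy s - dx s) * x s a * M.P s a s') := by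
    intro s'
    have ey : dy s' = _ := occupancy_eq M hμ hκ hq hy s'
    have ex : dx s' = _ := occupancy_eq M hμ zero_le_one (by simpa using M.γ_lt_one) hx' s'
    rw [ey, ex, add_sub_add_left_eq_sub, ← mul_sub]
    simp only [← Finset.sum_sub_distrib, ← Finset.sum_add_distrib]
    congr 1
    exact Finset.sum_congr rfl fun s _ => Finset.sum_congr rfl fun a _ => by ring
  have h3 : ∑ s, |dy s - dx s|
      ≤ M.γ * ((1 - M.γ * κ)⁻¹ * δ + (∑ s, |dy s - dx s|) * 1) := by
    calc ∑ s', |dy s' - dx s'|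
        ≤ ∑ s', M.γ * (|∑ s, ∑ a, dy s * (y s a - x s a) * M.P s a s'|
            + |∑ s, ∑ a, (dy s - dx s) * x s a * M.P s a s'|) := by
          refine Finset.sum_le_sum fun s' _ => ?_
          rw [e, abs_mul, abs_of_nonneg M.γ_nonneg]
          exact mul_le_mul_of_nonneg_left (abs_add_le _ _) M.γ_nonneg
      _ ≤ _ := by
          rw [← Finset.mul_sum, Finset.sum_add_distrib]
          refine mul_le_mul_of_nonneg_left (add_le_add ?_ ?_) M.γ_nonneg
          · refine (sum_abs_kernel_le M fun s a => dy s * (y s a - x s a)).trans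
              ((sum_abs_mul_le dy (y := fun s a => y s a - x s a) hyx).trans ?_)
            exact mul_le_mul_of_nonneg_right (sum_abs_occupancy_le M hμ hκ hq hy) hδ
          · exact (sum_abs_kernel_le M fun s a => (dy s - dx s) * x s a).trans
              (sum_abs_mul_le (fun s => dy s - dx s) hx')
  rw [← div_div, le_div_iff₀ h1, div_eq_mul_inv]
  nlinarith

/-! ### Value functions, performance difference and relative smoothness. -/

/-- The `h`-step expected reward `𝔼[R (s_h, a_h) | s_0 = s]`. -/
noncomputable def stepReward (x : S → A → ℝ) : ℕ → S → ℝ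
  | 0 => fun s => ∑ a, x s a * M.R s a
  | h + 1 => fun s => ∑ a, x s a * ∑ s', M.P s a s' * stepReward x h s'

/-- The state value function of a policy. -/
noncomputable def stateValue (x : S → A → ℝ) (s : S) : ℝ := ∑' h : ℕ, M.γ ^ h * stepReward M x h s

/-- The action value function of a policy. -/
noncomputable def actionValue (x : S → A → ℝ) (s : S) (a : A) : ℝ :=
  M.R s a + M.γ * ∑ s', M.P s a s' * stateValue M x s'

theorem sum_weights_mem_Icc {ι : Type*} [Fintype ι] {w f : ι → ℝ} (hw : w ∈ stdSimplex ℝ ι)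
    {c : ℝ} (hf : ∀ i, f i ∈ Set.Icc 0 c) : ∑ i, w i * f i ∈ Set.Icc 0 c := by
  refine ⟨Finset.sum_nonneg fun i _ => mul_nonneg (hw.1 i) (hf i).1, ?_⟩
  calc ∑ i, w i * f i ≤ ∑ i, w i * c :=
        Finset.sum_le_sum fun i _ => mul_le_mul_of_nonneg_left (hf i).2 (hw.1 i)
    _ = c := by rw [← Finset.sum_mul, hw.2, one_mul]

theorem stepReward_mem_Icc {x : S → A → ℝ} (hx : x ∈ policies S A) (h : ℕ) (s : S) :
    stepReward M x h s ∈ Set.Icc 0 1 := by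
  induction h generalizing s with
  | zero => exact sum_weights_mem_Icc (hx s) (M.R_mem s)
  | succ h ih =>
    exact sum_weights_mem_Icc (hx s) fun a => sum_weights_mem_Icc ⟨M.P_nonneg s a, M.P_sum s a⟩ ih

theorem summable_stepReward {x : S → A → ℝ} (hx : x ∈ policies S A) (s : S) :
    Summable fun h => M.γ ^ h * stepReward M x h s :=
  Summable.of_nonneg_of_le
    (fun h => mul_nonneg (pow_nonneg M.γ_nonneg h) (stepReward_mem_Icc M hx h s).1)
    (fun h => mul_le_of_le_one_right (pow_nonneg M.γ_nonneg h) (stepReward_mem_Icc M hx h s).2)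
    (summable_geometric_of_lt_one M.γ_nonneg M.γ_lt_one)

theorem stateValue_mem_Icc {x : S → A → ℝ} (hx : x ∈ policies S A) (s : S) :
    stateValue M x s ∈ Set.Icc 0 (1 - M.γ)⁻¹ := by
  refine ⟨tsum_nonneg fun h =>
    mul_nonneg (pow_nonneg M.γ_nonneg h) (stepReward_mem_Icc M hx h s).1, ?_⟩
  rw [← tsum_geometric_of_lt_one M.γ_nonneg M.γ_lt_one]
  exact (summable_stepReward M hx s).tsum_le_tsum
    (fun h => mul_le_of_le_one_right (pow_nonneg M.γ_nonneg h) (stepReward_mem_Icc M hx h s).2)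
    (summable_geometric_of_lt_one M.γ_nonneg M.γ_lt_one)

theorem actionValue_mem_Icc {x : S → A → ℝ} (hx : x ∈ policies S A) (s : S) (a : A) :
    actionValue M x s a ∈ Set.Icc 0 (1 - M.γ)⁻¹ := by
  have h1 : (0 : ℝ) < 1 - M.γ := by linarith [M.γ_lt_one]
  have h2 := sum_weights_mem_Icc ⟨M.P_nonneg s a, M.P_sum s a⟩ (stateValue_mem_Icc M hx)
  refine ⟨add_nonneg (M.R_mem s a).1 (mul_nonneg M.γ_nonneg h2.1), ?_⟩
  have h3 := mul_le_mul_of_nonneg_left h2.2 M.γ_nonneg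
  have h4 : 1 + M.γ * (1 - M.γ)⁻¹ = (1 - M.γ)⁻¹ := by field_simp; ring
  unfold actionValue
  linarith [(M.R_mem s a).2]

theorem stateValue_eq {x : S → A → ℝ} (hx : x ∈ policies S A) (s : S) :
    stateValue M x s = ∑ a, x s a * actionValue M x s a := by
  have hs := summable_stepReward M hx
  have h1 : ∀ h, M.γ ^ (h + 1) * stepReward M x (h + 1) s
      = ∑ a, ∑ s', x s a * M.γ * M.P s a s' * (M.γ ^ h * stepReward M x h s') := by
    intro h
    simp only [stepReward, Finset.mul_sum]
    exact Finset.sum_congr rfl fun a _ => Finset.sum_congr rfl fun s' _ => by ring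
  unfold actionValue
  simp only [mul_add, Finset.sum_add_distrib]
  rw [stateValue, (hs s).tsum_eq_zero_add]
  congr 1
  · simp [stepReward]
  · simp only [h1]
    rw [Summable.tsum_finsetSum fun a _ => summable_sum fun s' _ => (hs s').mul_left _]
    refine Finset.sum_congr rfl fun a _ => ?_
    rw [Summable.tsum_finsetSum fun s' _ => (hs s').mul_left _]
    simp only [tsum_mul_left, Finset.mul_sum, stateValue]
    exact Finset.sum_congr rfl fun s' _ => by ring

/-- The performance difference lemma. -/
theorem performance_difference (hμ : μ ∈ stdSimplex ℝ S) {x y : S → A → ℝ} {κ : ℝ} (hκ : 0 ≤ κ)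
    (hq : M.γ * κ < 1) (hx : x ∈ policies S A) (hy : ∀ s, ∑ a, |y s a| ≤ κ) :
    expectedReturn M μ y = ∑ s, μ s * stateValue M x s
      + ∑ s, occupancy M μ y s * ∑ a, (y s a - x s a) * actionValue M x s a := by
  set d := occupancy M μ y
  -- Solving the flow equation of `d` for `μ` rewrites the value of `x` at the start as a sum over
  -- the occupancy of `y`.
  have h1 : ∑ s, μ s * stateValue M x s = ∑ s, d s * stateValue M x s
      - ∑ s, ∑ a, d s * (y s a * (M.γ * ∑ s', M.P s a s' * stateValue M x s')) := by
    have e : ∀ s', μ s' = d s' - M.γ * ∑ s, ∑ a, d s * y s a * M.P s a s' := fun s' => by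
      rw [eq_sub_iff_add_eq]; exact (occupancy_eq M hμ hκ hq hy s').symm
    rw [Finset.sum_congr rfl fun s' _ => by rw [e s', sub_mul], Finset.sum_sub_distrib]
    congr 1
    simp only [Finset.mul_sum, Finset.sum_mul]
    rw [Finset.sum_comm]
    refine Finset.sum_congr rfl fun s _ => ?_
    rw [Finset.sum_comm]
    exact Finset.sum_congr rfl fun a _ => Finset.sum_congr rfl fun s' _ => by ring
  rw [h1, expectedReturn_eq M hμ hκ hq hy]
  rw [sub_add_eq_add_sub, eq_sub_iff_add_eq, ← Finset.sum_add_distrib, ← Finset.sum_add_distrib]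
  refine Finset.sum_congr rfl fun s _ => ?_
  rw [stateValue_eq M hx s, ← Finset.sum_add_distrib, ← mul_add, ← Finset.sum_add_distrib,
    Finset.mul_sum]
  refine Finset.sum_congr rfl fun a _ => ?_
  unfold actionValue
  ring

/-- Quadratic remainder of the first-order expansion of the return at a policy. -/
theorem abs_expectedReturn_sub_le (hμ : μ ∈ stdSimplex ℝ S) {x y : S → A → ℝ} {κ δ : ℝ}
    (hκ : 0 ≤ κ) (hδ : 0 ≤ δ) (hq : M.γ * κ < 1) (hx : x ∈ policies S A)
    (hy : ∀ s, ∑ a, |y s a| ≤ κ) (hyx : ∀ s, ∑ a, |y s a - x s a| ≤ δ) :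
    |expectedReturn M μ y - expectedReturn M μ x
        - ∑ s, occupancy M μ x s * ∑ a, (y s a - x s a) * actionValue M x s a|
      ≤ M.γ / ((1 - M.γ * κ) * (1 - M.γ) ^ 2) * δ ^ 2 := by
  have h1 : (0 : ℝ) < 1 - M.γ := by linarith [M.γ_lt_one]
  have h2 : (0 : ℝ) < 1 - M.γ * κ := by linarith
  have ey := performance_difference M hμ hκ hq hx hy
  -- At `y = x` the advantage sum vanishes, so both returns share the same leading term. The only
  -- remainder comes from replacing the occupancy of `y` by that of `x`, and it is a product of two
  -- factors of order `δ`.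
  have ex := performance_difference M hμ zero_le_one (by simpa using M.γ_lt_one) hx
    (sum_abs_policy hx)
  simp only [sub_self, zero_mul, Finset.sum_const_zero, mul_zero, add_zero] at ex
  rw [ey, ex, add_sub_cancel_left, ← Finset.sum_sub_distrib]
  simp only [← sub_mul]
  calc _ ≤ ∑ s, |occupancy M μ y s - occupancy M μ x s| * (δ * (1 - M.γ)⁻¹) := by
        refine (Finset.abs_sum_le_sum_abs _ _).trans (Finset.sum_le_sum fun s _ => ?_)
        rw [abs_mul]
        refine mul_le_mul_of_nonneg_left ?_ (abs_nonneg _)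
        calc |∑ a, (y s a - x s a) * actionValue M x s a|
            ≤ ∑ a, |y s a - x s a| * (1 - M.γ)⁻¹ := by
              refine (Finset.abs_sum_le_sum_abs _ _).trans (Finset.sum_le_sum fun a _ => ?_)
              have hQ := actionValue_mem_Icc M hx s a
              rw [abs_mul, abs_of_nonneg hQ.1]
              exact mul_le_mul_of_nonneg_left hQ.2 (abs_nonneg _)
          _ ≤ _ := by
              rw [← Finset.sum_mul]
              exact mul_le_mul_of_nonneg_right (hyx s) (inv_nonneg.2 h1.le)
    _ ≤ M.γ * δ / ((1 - M.γ * κ) * (1 - M.γ)) * (δ * (1 - M.γ)⁻¹) := by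
        rw [← Finset.sum_mul]
        exact mul_le_mul_of_nonneg_right
          (sum_abs_occupancy_sub_le M hμ hκ hδ hq hx hy hyx) (by positivity)
    _ = _ := by field_simp

/-- The derivative of `V_μ` at a policy (policy gradient theorem). -/
theorem hasFDerivAt_V (hμ : μ ∈ stdSimplex ℝ S) {x : S → A → ℝ} (hx : x ∈ policies S A) :
    HasFDerivAt (V M μ) (∑ s, ∑ a, (-(occupancy M μ x s * actionValue M x s a)) •
      ((ContinuousLinearMap.proj (R := ℝ) (φ := fun _ : A => ℝ) a).comp
        (ContinuousLinearMap.proj (R := ℝ) (φ := fun _ : S => A → ℝ) s))) x := by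
  have h0 := M.γ_nonneg
  have h1 : (0 : ℝ) < 1 - M.γ := by linarith [M.γ_lt_one]
  -- Any `κ` with `1 < κ` and `γκ < 1` works: the first leaves room for a neighbourhood of the
  -- simplex, the second keeps the series convergent there.
  set κ : ℝ := 2 / (1 + M.γ)
  have hκ1 : 1 < κ := by rw [lt_div_iff₀ (by linarith)]; linarith
  have hq : M.γ * κ < 1 := by rw [← mul_div_assoc, div_lt_one (by linarith)]; linarith
  rw [hasFDerivAt_iff_isLittleO]
  set c : ℝ := (Fintype.card A : ℝ)
  refine (Asymptotics.IsBigO.of_bound (M.γ / ((1 - M.γ * κ) * (1 - M.γ) ^ 2) * c ^ 2)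
    ?_).trans_isLittleO (Asymptotics.isLittleO_pow_sub_sub x one_lt_two)
  have hev : ∀ᶠ y in nhds x, c * ‖y - x‖ < κ - 1 := by
    have : Continuous fun y : S → A → ℝ => c * ‖y - x‖ := by fun_prop
    exact this.continuousAt.eventually_lt continuousAt_const (by simpa using hκ1)
  filter_upwards [hev] with y hy
  have hyx : ∀ s, ∑ a, |y s a - x s a| ≤ c * ‖y - x‖ := fun s =>
    calc ∑ a, |y s a - x s a| ≤ ∑ _a : A, ‖y - x‖ := Finset.sum_le_sum fun a _ =>
          ((norm_le_pi_norm ((y - x) s) a).trans (norm_le_pi_norm (y - x) s))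
      _ = _ := by simp [c]
  have hyκ : ∀ s, ∑ a, |y s a| ≤ κ := fun s =>
    calc ∑ a, |y s a| ≤ ∑ a, (|y s a - x s a| + |x s a|) :=
          Finset.sum_le_sum fun a _ => by simpa using abs_add_le (y s a - x s a) (x s a)
      _ ≤ κ := by
          rw [Finset.sum_add_distrib]
          linarith [hyx s, sum_abs_policy hx s]
  have hb := abs_expectedReturn_sub_le M hμ (by linarith) (by positivity) hq hx hyκ hyx
  have e : V M μ y - V M μ x - (∑ s, ∑ a, (-(occupancy M μ x s * actionValue M x s a)) •
      ((ContinuousLinearMap.proj (R := ℝ) (φ := fun _ : A => ℝ) a).comp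
        (ContinuousLinearMap.proj (R := ℝ) (φ := fun _ : S => A → ℝ) s))) (y - x)
      = -(expectedReturn M μ y - expectedReturn M μ x
        - ∑ s, occupancy M μ x s * ∑ a, (y s a - x s a) * actionValue M x s a) := by
    have : (∑ s, ∑ a, (-(occupancy M μ x s * actionValue M x s a)) •
      ((ContinuousLinearMap.proj (R := ℝ) (φ := fun _ : A => ℝ) a).comp
        (ContinuousLinearMap.proj (R := ℝ) (φ := fun _ : S => A → ℝ) s))) (y - x)
        = - ∑ s, occupancy M μ x s * ∑ a, (y s a - x s a) * actionValue M x s a := by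
      simp only [_root_.sum_apply, _root_.smul_apply,
        ContinuousLinearMap.comp_apply, ContinuousLinearMap.proj_apply, Pi.sub_apply, smul_eq_mul,
        Finset.mul_sum, ← Finset.sum_neg_distrib]
      exact Finset.sum_congr rfl fun s _ => Finset.sum_congr rfl fun a _ => by ring
    rw [this]
    unfold V
    ring
  rw [e, norm_neg, Real.norm_eq_abs]
  refine hb.trans_eq ?_
  rw [norm_pow, norm_norm]
  ring

theorem pairing_gradV [DecidableEq S] [DecidableEq A] (hμ : μ ∈ stdSimplex ℝ S)
    {x : S → A → ℝ} (hx : x ∈ policies S A) (u : S → A → ℝ) :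
    pairing (gradV M μ x) u
      = - ∑ s, occupancy M μ x s * ∑ a, u s a * actionValue M x s a := by
  unfold pairing gradV
  rw [(hasFDerivAt_V M hμ hx).fderiv, ← Finset.sum_neg_distrib]
  refine Finset.sum_congr rfl fun s _ => ?_
  rw [Finset.mul_sum, ← Finset.sum_neg_distrib]
  refine Finset.sum_congr rfl fun a _ => ?_
  have : (∑ s', ∑ a', (-(occupancy M μ x s' * actionValue M x s' a')) •
      ((ContinuousLinearMap.proj (R := ℝ) (φ := fun _ : A => ℝ) a').comp
        (ContinuousLinearMap.proj (R := ℝ) (φ := fun _ : S => A → ℝ) s')))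
        (Pi.single s (Pi.single a (1 : ℝ))) = -(occupancy M μ x s * actionValue M x s a) := by
    simp only [_root_.sum_apply, _root_.smul_apply,
        ContinuousLinearMap.comp_apply, ContinuousLinearMap.proj_apply, smul_eq_mul]
    rw [Finset.sum_eq_single s, Finset.sum_eq_single a]
    · simp
    · intro b _ hb
      simp [hb]
    · simp
    · intro b _ hb
      simp [hb]
    · simp
  rw [this]
  ring

theorem smoothConst_nonneg : 0 ≤ smoothConst M := by
  have h1 : (0 : ℝ) < 1 - M.γ := by linarith [M.γ_lt_one]
  have := M.γ_nonneg
  unfold smoothConst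
  positivity

/-- `V_μ` is smooth relative to the entropy. -/
theorem relative_smoothness [DecidableEq S] [DecidableEq A] (hμ : μ ∈ stdSimplex ℝ S)
    {x y : S → A → ℝ} (hx : x ∈ policies S A ∩ zone S A) (hy : y ∈ policies S A) :
    |V M μ y - V M μ x - pairing (gradV M μ x) (y - x)| ≤ smoothConst M * bregman y x := by
  have h1 : (0 : ℝ) < 1 - M.γ := by linarith [M.γ_lt_one]
  -- The `(2, 1)`-norm of `y - x` dominates the `ℓ¹` norm of every row. With `κ = 1` the remainder
  -- constant is `ℓ / 2`, which matches the `1 / 2` in Pinsker's inequality.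
  set δ : ℝ := Real.sqrt (∑ s, (∑ a, |y s a - x s a|) ^ 2)
  have hδ2 : δ ^ 2 = ∑ s, (∑ a, |y s a - x s a|) ^ 2 :=
    Real.sq_sqrt (Finset.sum_nonneg fun _ _ => sq_nonneg _)
  have hyx : ∀ s, ∑ a, |y s a - x s a| ≤ δ := fun s => Real.le_sqrt_of_sq_le
    (Finset.single_le_sum (f := fun s => (∑ a, |y s a - x s a|) ^ 2)
      (fun _ _ => sq_nonneg _) (Finset.mem_univ s))
  have hb := abs_expectedReturn_sub_le M hμ zero_le_one (Real.sqrt_nonneg _)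
    (by simpa using M.γ_lt_one) hx.1 (sum_abs_policy hy) hyx
  rw [pairing_gradV M hμ hx.1]
  have e : V M μ y - V M μ x
      - -∑ s, occupancy M μ x s * ∑ a, (y - x) s a * actionValue M x s a
      = -(expectedReturn M μ y - expectedReturn M μ x
        - ∑ s, occupancy M μ x s * ∑ a, (y s a - x s a) * actionValue M x s a) := by
    unfold V
    simp only [Pi.sub_apply]
    ring
  rw [e, abs_neg]
  refine hb.trans ?_
  have h2 : M.γ / ((1 - M.γ * 1) * (1 - M.γ) ^ 2) * δ ^ 2
      = smoothConst M * (1 / 2 * δ ^ 2) := by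
    unfold smoothConst
    field_simp
  rw [h2, hδ2]
  exact mul_le_mul_of_nonneg_left (sum_sq_le_bregman hy hx) (smoothConst_nonneg M)

theorem continuousOn_V (hμ : μ ∈ stdSimplex ℝ S) : ContinuousOn (V M μ) (policies S A) :=
  fun _ hx => (hasFDerivAt_V M hμ hx).continuousAt.continuousWithinAt

theorem exists_abs_V_le (hμ : μ ∈ stdSimplex ℝ S) :
    ∃ B, ∀ y ∈ policies S A, |V M μ y| ≤ B :=
  (isCompact_policies (S := S) (A := A)).exists_bound_of_continuousOn (continuousOn_V M hμ)

theorem optV_le (hμ : μ ∈ stdSimplex ℝ S) {y : S → A → ℝ} (hy : y ∈ policies S A) :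
    optV M μ ≤ V M μ y := by
  obtain ⟨B, hB⟩ := exists_abs_V_le M hμ
  refine csInf_le ⟨-B, ?_⟩ (Set.mem_image_of_mem _ hy)
  rintro _ ⟨z, hz, rfl⟩
  exact (abs_le.1 (hB z hz)).1

end Smoothness

/-! ### Moreau and forward-backward envelopes, and descent along one step. -/

section Envelopes

variable {S A : Type*} [Fintype S] [Fintype A] (M : DMDP S A) {μ : S → ℝ}

/-- The minimum over the policies of a fixed function, perturbed by a linear one and a constant. -/
noncomputable def perturbedInf (ψ : (S → A → ℝ) → ℝ) (p : (S → A → ℝ) × ℝ) : ℝ :=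
  sInf ((fun y => pairing p.1 y + ψ y + p.2) '' policies S A)

/-- A jointly continuous function minimized over a compact set. Both envelopes have this form in the
variables `logMat x`, `gradV M μ x` and `x`, so their measurability reduces to that of these
variables. -/
theorem continuous_perturbedInf {ψ : (S → A → ℝ) → ℝ} (hψ : ContinuousOn ψ (policies S A)) :
    Continuous (perturbedInf ψ) := by
  have : CompactSpace (policies S A) := isCompact_iff_compactSpace.1 isCompact_policies
  have h : Continuous fun p : ((S → A → ℝ) × ℝ) × policies S A =>
      pairing p.1.1 p.2 + ψ p.2 + p.1.2 := by
    have h1 := continuousOn_iff_continuous_domRestrict.1 hψ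
    have h2 : Continuous fun p : ((S → A → ℝ) × ℝ) × policies S A => ψ p.2 :=
      h1.comp continuous_snd
    have h3 : Continuous fun p : ((S → A → ℝ) × ℝ) × policies S A => pairing p.1.1 p.2 :=
      continuous_pairing (by fun_prop) (by fun_prop)
    exact (h3.add h2).add (by fun_prop)
  have := isCompact_univ.continuous_sInf
    (f := fun (p : (S → A → ℝ) × ℝ) (y : policies S A) => pairing p.1 y + ψ y + p.2) h
  convert this using 2 with p
  unfold perturbedInf
  congr 1
  ext r
  simp

theorem moreauEnv_eq_perturbedInf {ρ : ℝ} {x : S → A → ℝ} (hx : x ∈ policies S A ∩ zone S A) :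
    moreauEnv M μ ρ x
      = perturbedInf (fun y => V M μ y + ρ * entropy y) (-ρ • logMat x, 0) := by
  unfold moreauEnv perturbedInf
  congr 1
  refine Set.image_congr fun y hy => ?_
  rw [bregman_eq hy hx, pairing_smul]
  ring

theorem bfbe_eq_perturbedInf [DecidableEq S] [DecidableEq A] {ρ : ℝ} {x : S → A → ℝ}
    (hx : x ∈ policies S A ∩ zone S A) :
    bfbe M μ ρ x = -2 * ρ * perturbedInf (fun y => ρ * entropy y)
      (gradV M μ x - ρ • logMat x, - pairing (gradV M μ x) x) := by
  unfold bfbe perturbedInf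
  congr 2
  refine Set.image_congr fun y hy => ?_
  rw [bregman_eq hy hx, pairing_sub, sub_pairing, pairing_smul]
  ring

theorem continuousOn_bregman {x : S → A → ℝ} (hx : x ∈ policies S A ∩ zone S A) :
    ContinuousOn (fun y => bregman y x) (policies S A) := by
  have : Continuous fun y : S → A → ℝ => entropy y - pairing (logMat x) y :=
    continuous_entropy.sub (continuous_pairing (by fun_prop) (by fun_prop))
  exact this.continuousOn.congr fun y hy => bregman_eq hy hx

theorem continuousOn_proxObjective (hμ : μ ∈ stdSimplex ℝ S) (ρ : ℝ) {x : S → A → ℝ}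
    (hx : x ∈ policies S A ∩ zone S A) :
    ContinuousOn (fun y => V M μ y + ρ * bregman y x) (policies S A) :=
  (continuousOn_V M hμ).add ((continuousOn_bregman hx).const_mul ρ)

/-- The Bregman proximal point exists. -/
theorem exists_moreauEnv_eq (hμ : μ ∈ stdSimplex ℝ S) (ρ : ℝ) {x : S → A → ℝ}
    (hx : x ∈ policies S A ∩ zone S A) :
    ∃ z ∈ policies S A, moreauEnv M μ ρ x = V M μ z + ρ * bregman z x :=
  isCompact_policies.exists_sInf_image_eq ⟨x, hx.1⟩ (continuousOn_proxObjective M hμ ρ hx)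

theorem moreauEnv_le (hμ : μ ∈ stdSimplex ℝ S) (ρ : ℝ) {x y : S → A → ℝ}
    (hx : x ∈ policies S A ∩ zone S A) (hy : y ∈ policies S A) :
    moreauEnv M μ ρ x ≤ V M μ y + ρ * bregman y x :=
  csInf_le (isCompact_policies.bddBelow_image (continuousOn_proxObjective M hμ ρ hx))
    (Set.mem_image_of_mem _ hy)

theorem moreauEnv_le_V (hμ : μ ∈ stdSimplex ℝ S) (ρ : ℝ) {x : S → A → ℝ}
    (hx : x ∈ policies S A ∩ zone S A) : moreauEnv M μ ρ x ≤ V M μ x := by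
  simpa [bregman_self] using moreauEnv_le M hμ ρ hx hx.1

theorem optV_le_moreauEnv (hμ : μ ∈ stdSimplex ℝ S) {ρ : ℝ} (hρ : 0 ≤ ρ) {x : S → A → ℝ}
    (hx : x ∈ policies S A ∩ zone S A) : optV M μ ≤ moreauEnv M μ ρ x := by
  obtain ⟨z, hz, h⟩ := exists_moreauEnv_eq M hμ ρ hx
  have := mul_nonneg hρ (bregman_nonneg hz hx)
  linarith [optV_le M hμ hz]

variable [DecidableEq S] [DecidableEq A]

theorem bfbe_nonneg {ρ : ℝ} (hρ : 0 ≤ ρ) {x : S → A → ℝ}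
    (hx : x ∈ policies S A ∩ zone S A) : 0 ≤ bfbe M μ ρ x := by
  have hc : ContinuousOn (fun y => pairing (gradV M μ x) (y - x) + ρ * bregman y x)
      (policies S A) := by
    have : Continuous fun y : S → A → ℝ => pairing (gradV M μ x) (y - x) :=
      continuous_pairing (by fun_prop) (by fun_prop)
    exact this.continuousOn.add ((continuousOn_bregman hx).const_mul ρ)
  have h := csInf_le (isCompact_policies.bddBelow_image hc) (Set.mem_image_of_mem _ hx.1)
  simp only [sub_self, bregman_self, mul_zero, add_zero] at h
  have h0 : pairing (gradV M μ x) (0 : S → A → ℝ) = 0 := by simp [pairing]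
  rw [h0] at h
  unfold bfbe
  nlinarith

/-- By the upper half of relative smoothness, the linear model with weight `3ℓ` dominates `V(y) -
V(x)` with weight `2ℓ`: one `ℓ` pays for the linearization. The factor `6ℓ` is `2ρ`. -/
theorem bfbe_le (hμ : μ ∈ stdSimplex ℝ S) {x : S → A → ℝ}
    (hx : x ∈ policies S A ∩ zone S A) :
    bfbe M μ (3 * smoothConst M) x
      ≤ 6 * smoothConst M * (V M μ x - moreauEnv M μ (2 * smoothConst M) x) := by
  have hl := smoothConst_nonneg M
  have h : moreauEnv M μ (2 * smoothConst M) x - V M μ x ≤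
      sInf ((fun y => pairing (gradV M μ x) (y - x) + 3 * smoothConst M * bregman y x) ''
        policies S A) := by
    refine le_csInf (Set.Nonempty.image _ ⟨x, hx.1⟩) ?_
    rintro _ ⟨y, hy, rfl⟩
    have h1 := (abs_le.1 (relative_smoothness M hμ hx hy)).2
    have h2 := moreauEnv_le M hμ (2 * smoothConst M) hx hy
    dsimp only
    linarith
  unfold bfbe
  nlinarith

theorem bfbe_le_optV_gap (hμ : μ ∈ stdSimplex ℝ S) {x : S → A → ℝ}
    (hx : x ∈ policies S A ∩ zone S A) :
    bfbe M μ (3 * smoothConst M) x ≤ 6 * smoothConst M * (V M μ x - optV M μ) := by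
  have hl := smoothConst_nonneg M
  refine (bfbe_le M hμ hx).trans (mul_le_mul_of_nonneg_left ?_ (by positivity))
  linarith [optV_le_moreauEnv M hμ (ρ := 2 * smoothConst M) (by positivity) hx]

/-- The potential that decreases along the iterations. -/
noncomputable def potential (μ : S → ℝ) (η : ℝ) (x : S → A → ℝ) : ℝ :=
  moreauEnv M μ (2 * smoothConst M) x + 2 * smoothConst M * η * V M μ x

/-- Pathwise descent of the potential in one mirror step along an arbitrary direction. -/
theorem potential_mwUpdate_le (hμ : μ ∈ stdSimplex ℝ S) {η : ℝ} (hη : 0 ≤ η)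
    (hηl : η * smoothConst M ≤ 1 / 2) {x z : S → A → ℝ} (hx : x ∈ policies S A ∩ zone S A)
    (hz : z ∈ policies S A)
    (hzx : moreauEnv M μ (2 * smoothConst M) x = V M μ z + 2 * smoothConst M * bregman z x)
    (G : S → A → ℝ) :
    potential M μ η (mwUpdate η G x) ≤ potential M μ η x
      - η / 3 * bfbe M μ (3 * smoothConst M) x
      + 2 * smoothConst M * η * pairing (G - gradV M μ x) (z - x)
      + 2 * smoothConst M * η ^ 2 * sqNormTwoInf (G - gradV M μ x) := by
  set l := smoothConst M
  have hl : 0 ≤ l := smoothConst_nonneg M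
  set x' := mwUpdate η G x
  have hx' : x' ∈ policies S A ∩ zone S A := mwUpdate_mem hx η G
  have h1 := moreauEnv_le M hμ (2 * l) hx' hz
  have h2 : bregman z x' = bregman z x - bregman x' x + η * pairing G (z - x') :=
    bregman_mwUpdate hz hx η G
  -- This half of `D(x', x)` and the half in `k1` below are together cancelled by the `-D(x', x)` of
  -- the three-point identity.
  have h3 : η * pairing (G - gradV M μ x) (x - x')
      ≤ η ^ 2 * sqNormTwoInf (G - gradV M μ x) + 1 / 2 * bregman x' x := by
    have a := pairing_le_young η (G - gradV M μ x) (x - x')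
    have b := sum_sq_le_bregman hx'.1 hx
    simp only [Pi.sub_apply (x : S → A → ℝ) x', Pi.sub_apply (x _) (x' _),
      abs_sub_comm (x _ _) (x' _ _)] at a
    linarith
  have h4 := (abs_le.1 (relative_smoothness M hμ hx hx'.1)).2
  have h5 := (abs_le.1 (relative_smoothness M hμ hx hz)).1
  have h6 := bfbe_le M hμ hx
  have hD := bregman_nonneg hx'.1 hx
  have hDz := bregman_nonneg hz hx
  have e : pairing G (z - x') = pairing (gradV M μ x) (z - x)
      - pairing (gradV M μ x) (x' - x) + pairing (G - gradV M μ x) (z - x)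
      + pairing (G - gradV M μ x) (x - x') := by
    simp only [pairing_sub, sub_pairing]
    ring
  have k1 : η * -pairing (gradV M μ x) (x' - x)
      ≤ η * (V M μ x - V M μ x') + 1 / 2 * bregman x' x := by
    have a : -pairing (gradV M μ x) (x' - x) ≤ V M μ x - V M μ x' + l * bregman x' x := by
      linarith
    have b := mul_le_mul_of_nonneg_left a hη
    have c := mul_le_mul_of_nonneg_right hηl hD
    linarith
  -- The lower half of relative smoothness at `z` costs `ℓ D(z, x)`, which the `2ℓ D(z, x)` inside
  -- the envelope covers.
  have k2 : 2 * l * η * pairing (gradV M μ x) (z - x)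
      ≤ - (η / 3 * bfbe M μ (3 * l) x) := by
    have a : pairing (gradV M μ x) (z - x) ≤ moreauEnv M μ (2 * l) x - V M μ x := by
      have := mul_nonneg hl hDz
      linarith
    have b := mul_le_mul_of_nonneg_left a (by positivity : 0 ≤ 2 * l * η)
    have c := mul_le_mul_of_nonneg_left h6 (by positivity : 0 ≤ η / 3)
    linarith
  have k3 : bregman z x' ≤ bregman z x + η * pairing (gradV M μ x) (z - x)
      + η * (V M μ x - V M μ x') + η * pairing (G - gradV M μ x) (z - x)
      + η ^ 2 * sqNormTwoInf (G - gradV M μ x) := by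
    rw [h2, e]
    linarith
  have k4 := mul_le_mul_of_nonneg_left k3 (by positivity : 0 ≤ 2 * l)
  unfold potential
  linarith

end Envelopes

/-! ### Measurability, integrability and expected descent. -/

section Stochastic

variable {S A : Type*} [Fintype S] [Fintype A] (M : DMDP S A) {μ : S → ℝ}

theorem measurable_pairing :
    Measurable fun p : (S → A → ℝ) × (S → A → ℝ) => pairing p.1 p.2 :=
  (continuous_pairing continuous_fst continuous_snd).measurable

omit [Fintype S] [Fintype A] in
theorem measurable_logMat : Measurable (logMat (S := S) (A := A)) := by
  unfold logMat
  exact measurable_pi_lambda _ fun s => measurable_pi_lambda _ fun a =>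
    Real.measurable_log.comp (by fun_prop)

omit [Fintype S] in
theorem measurable_mwUpdate (η : ℝ) :
    Measurable fun p : (S → A → ℝ) × (S → A → ℝ) => mwUpdate η p.1 p.2 := by
  unfold mwUpdate
  refine measurable_pi_lambda _ fun s => measurable_pi_lambda _ fun a => ?_
  fun_prop

theorem measurable_moreauEnv_comp (hμ : μ ∈ stdSimplex ℝ S) (ρ : ℝ) {Ω : Type*}
    [MeasurableSpace Ω] {f : Ω → S → A → ℝ} (hf : Measurable f)
    (hmem : ∀ ω, f ω ∈ policies S A ∩ zone S A) : Measurable fun ω => moreauEnv M μ ρ (f ω) := by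
  simp only [moreauEnv_eq_perturbedInf M (hmem _)]
  refine (continuous_perturbedInf ((continuousOn_V M hμ).add
    (continuous_entropy.const_mul ρ).continuousOn)).measurable.comp ?_
  exact ((measurable_logMat.comp hf).const_smul (-ρ)).prodMk measurable_const

theorem measurable_V_comp (hμ : μ ∈ stdSimplex ℝ S) {Ω : Type*}
    [MeasurableSpace Ω] {f : Ω → S → A → ℝ} (hf : Measurable f)
    (hmem : ∀ ω, f ω ∈ policies S A) : Measurable fun ω => V M μ (f ω) := by
  have h1 := continuousOn_iff_continuous_domRestrict.1 (continuousOn_V (A := A) M hμ)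
  have h2 : Measurable fun ω => (⟨f ω, hmem ω⟩ : policies S A) := hf.subtype_mk
  have h3 := h1.measurable.comp h2
  exact h3

variable [DecidableEq S] [DecidableEq A]

theorem measurable_gradV : Measurable (gradV M μ) := by
  unfold gradV
  exact measurable_pi_lambda _ fun s => measurable_pi_lambda _ fun a =>
    measurable_fderiv_apply_const ℝ _ _

theorem measurable_bfbe_comp (ρ : ℝ) {Ω : Type*}
    [MeasurableSpace Ω] {f : Ω → S → A → ℝ} (hf : Measurable f)
    (hmem : ∀ ω, f ω ∈ policies S A ∩ zone S A) : Measurable fun ω => bfbe M μ ρ (f ω) := by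
  simp only [bfbe_eq_perturbedInf M (hmem _)]
  have hg : Measurable fun ω => gradV M μ (f ω) := (measurable_gradV M).comp hf
  refine ((continuous_perturbedInf
    (continuous_entropy.const_mul ρ).continuousOn).measurable.comp ?_).const_mul _
  exact (hg.sub ((measurable_logMat.comp hf).const_smul ρ)).prodMk
    (measurable_pairing.comp (hg.prodMk hf)).neg

omit [DecidableEq S] [DecidableEq A] in
theorem measurable_potential_comp (hμ : μ ∈ stdSimplex ℝ S) (η : ℝ) {Ω : Type*}
    [MeasurableSpace Ω] {f : Ω → S → A → ℝ} (hf : Measurable f)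
    (hmem : ∀ ω, f ω ∈ policies S A ∩ zone S A) : Measurable fun ω => potential M μ η (f ω) :=
  (measurable_moreauEnv_comp M hμ _ hf hmem).add
    ((measurable_V_comp M hμ hf fun ω => (hmem ω).1).const_mul _)

omit [DecidableEq S] [DecidableEq A] in
-- Although `log x` is unbounded on positive policies, the envelope lies between `optV` and `V x`,
-- and `V` is bounded on the compact set of policies.
theorem exists_abs_potential_le (hμ : μ ∈ stdSimplex ℝ S) (η : ℝ) :
    ∃ B, ∀ x ∈ policies S A ∩ zone S A, |potential M μ η x| ≤ B := by
  obtain ⟨B, hB⟩ := exists_abs_V_le (S := S) (A := A) M hμ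
  refine ⟨B + |optV M μ| + |2 * smoothConst M * η| * B, fun x hx => ?_⟩
  have hl := smoothConst_nonneg M
  have h1 := hB x hx.1
  have h2 := moreauEnv_le_V M hμ (2 * smoothConst M) hx
  have h3 := optV_le_moreauEnv M hμ (ρ := 2 * smoothConst M) (by positivity) hx
  have h4 : |moreauEnv M μ (2 * smoothConst M) x| ≤ B + |optV M μ| := by
    rw [abs_le] at h1 ⊢
    constructor
    · linarith [neg_abs_le (optV M μ)]
    · linarith [abs_nonneg (optV M μ)]
  unfold potential
  refine (abs_add_le _ _).trans (add_le_add h4 ?_)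
  rw [abs_mul]
  exact mul_le_mul_of_nonneg_left h1 (abs_nonneg _)

theorem integrable_potential_comp (hμ : μ ∈ stdSimplex ℝ S) (η : ℝ) {Ω : Type*}
    [MeasurableSpace Ω] (Pr : Measure Ω) [IsFiniteMeasure Pr] {f : Ω → S → A → ℝ}
    (hf : Measurable f) (hmem : ∀ ω, f ω ∈ policies S A ∩ zone S A) :
    Integrable (fun ω => potential M μ η (f ω)) Pr := by
  obtain ⟨B, hB⟩ := exists_abs_potential_le (A := A) M hμ η
  exact Integrable.of_bound (measurable_potential_comp M hμ η hf hmem).aestronglyMeasurable B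
    (Filter.Eventually.of_forall fun ω => hB _ (hmem ω))

theorem integrable_bfbe_comp (hμ : μ ∈ stdSimplex ℝ S) {Ω : Type*}
    [MeasurableSpace Ω] (Pr : Measure Ω) [IsFiniteMeasure Pr] {f : Ω → S → A → ℝ}
    (hf : Measurable f) (hmem : ∀ ω, f ω ∈ policies S A ∩ zone S A) :
    Integrable (fun ω => bfbe M μ (3 * smoothConst M) (f ω)) Pr := by
  obtain ⟨B, hB⟩ := exists_abs_V_le (S := S) (A := A) M hμ
  have hl := smoothConst_nonneg M
  refine Integrable.of_bound (measurable_bfbe_comp M _ hf hmem).aestronglyMeasurable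
    (6 * smoothConst M * (B - optV M μ)) (Filter.Eventually.of_forall fun ω => ?_)
  rw [Real.norm_of_nonneg (bfbe_nonneg M (by positivity) (hmem ω))]
  refine (bfbe_le_optV_gap M hμ (hmem ω)).trans (mul_le_mul_of_nonneg_left ?_ (by positivity))
  linarith [(abs_le.1 (hB _ (hmem ω).1)).2]

variable {Ξ : Type*} [MeasurableSpace Ξ] {Q : Measure Ξ} [IsProbabilityMeasure Q]
  {g : (S → A → ℝ) → Ξ → S → A → ℝ} {σ : ℝ}

/-- Expected descent of the potential in one step from a fixed policy. -/
theorem integral_potential_mwUpdate_le (hμ : μ ∈ stdSimplex ℝ S) (hg : IsOracle M μ σ Q g)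
    {η : ℝ} (hη : 0 ≤ η) (hηl : η * smoothConst M ≤ 1 / 2) {x : S → A → ℝ}
    (hx : x ∈ policies S A ∩ zone S A) :
    ∫ z, potential M μ η (mwUpdate η (g x z) x) ∂Q ≤ potential M μ η x
      - η / 3 * bfbe M μ (3 * smoothConst M) x + 2 * smoothConst M * η ^ 2 * σ ^ 2 := by
  -- The proximal point is chosen for a fixed `x` before the sample is drawn. Hence the linear noise
  -- term is centred, and no measurable selection of proximal points is needed.
  obtain ⟨u, hu, hux⟩ := exists_moreauEnv_eq M hμ (2 * smoothConst M) hx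
  have hl := smoothConst_nonneg M
  have hm : Measurable fun z => mwUpdate η (g x z) x :=
    (measurable_mwUpdate η).comp
      ((hg.measurable.comp (measurable_const.prodMk measurable_id)).prodMk measurable_const)
  have hterm : ∀ s a, Integrable (fun z => (g x z - gradV M μ x) s a * (u - x) s a) Q :=
    fun s a => ((hg.integrable x hx.1 s a).sub (integrable_const _)).mul_const _
  have hpi : Integrable (fun z => pairing (g x z - gradV M μ x) (u - x)) Q :=
    integrable_finsetSum _ fun s _ => integrable_finsetSum _ fun a _ => hterm s a
  have hp0 : ∫ z, pairing (g x z - gradV M μ x) (u - x) ∂Q = 0 := by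
    unfold pairing
    rw [integral_finsetSum _ fun s _ => integrable_finsetSum _ fun a _ => hterm s a]
    refine Finset.sum_eq_zero fun s _ => ?_
    rw [integral_finsetSum _ fun a _ => hterm s a]
    refine Finset.sum_eq_zero fun a _ => ?_
    rw [integral_mul_const]
    simp only [Pi.sub_apply]
    rw [integral_sub (hg.integrable x hx.1 s a) (integrable_const _), hg.unbiased x hx.1 s a]
    simp
  have hsq := hg.integrable_sq x hx.1
  have hi1 := (integrable_const (μ := Q) (potential M μ η x
      - η / 3 * bfbe M μ (3 * smoothConst M) x)).add (hpi.const_mul (2 * smoothConst M * η))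
  have hi2 := hsq.const_mul (2 * smoothConst M * η ^ 2)
  refine (integral_mono (integrable_potential_comp M hμ η Q hm fun z => mwUpdate_mem hx η _)
    (hi1.add hi2) fun z => potential_mwUpdate_le M hμ hη hηl hx hu hux (g x z)).trans ?_
  rw [integral_add' hi1 hi2, integral_add' (integrable_const _) (hpi.const_mul _),
    integral_const_mul, integral_const_mul, hp0]
  have := mul_le_mul_of_nonneg_left (hg.variance_le x hx.1)
    (by positivity : 0 ≤ 2 * smoothConst M * η ^ 2)
  simp only [integral_const, probReal_univ, one_smul, mul_zero, add_zero]
  linarith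

/-- The positive policies. -/
abbrev posPolicies (S A : Type*) [Fintype A] : Set (S → A → ℝ) := policies S A ∩ zone S A

variable {Ω : Type*} [MeasurableSpace Ω] {Pr : Measure Ω} [IsProbabilityMeasure Pr]

omit [IsProbabilityMeasure Q] [Fintype S] [Fintype A] [DecidableEq S] [DecidableEq A] in
-- Under independence the joint law is a product, so Fubini replaces conditioning on the past. The
-- bound is required at every `y : K`, which is why iterates are later taken with values in the
-- subtype of positive policies.
theorem integral_comp_le_of_indepFun [SFinite Q] {K : Type*} [MeasurableSpace K] {Y : Ω → K}
    (hY : Measurable Y) {ζ : Ω → Ξ} (hζ : Measurable ζ) (hlaw : Pr.map ζ = Q)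
    (hind : IndepFun Y ζ Pr) {F : K × Ξ → ℝ} (hF : Integrable F ((Pr.map Y).prod Q))
    {H : K → ℝ} (hH : Integrable H (Pr.map Y)) (h : ∀ y, ∫ z, F (y, z) ∂Q ≤ H y) :
    ∫ ω, F (Y ω, ζ ω) ∂Pr ≤ ∫ ω, H (Y ω) ∂Pr := by
  have hjoint : Pr.map (fun ω => (Y ω, ζ ω)) = (Pr.map Y).prod Q := by
    rw [(indepFun_iff_map_prod_eq_prod_map_map hY.aemeasurable hζ.aemeasurable).1 hind, hlaw]
  rw [← integral_map hY.aemeasurable hH.aestronglyMeasurable,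
    ← integral_map (hY.prodMk hζ).aemeasurable (hjoint ▸ hF.aestronglyMeasurable), hjoint,
    integral_prod _ hF]
  exact integral_mono hF.integral_prod_left hH h

/-- Expected descent of the potential in one step from a random policy. -/
theorem integral_potential_step_le (hμ : μ ∈ stdSimplex ℝ S) (hg : IsOracle M μ σ Q g)
    {η : ℝ} (hη : 0 ≤ η) (hηl : η * smoothConst M ≤ 1 / 2) {Y : Ω → posPolicies S A}
    (hY : Measurable Y) {ζ : Ω → Ξ} (hζ : Measurable ζ) (hlaw : Pr.map ζ = Q)
    (hind : IndepFun Y ζ Pr) :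
    ∫ ω, potential M μ η (mwUpdate η (g (Y ω) (ζ ω)) (Y ω)) ∂Pr
      ≤ ∫ ω, potential M μ η (Y ω) ∂Pr
        - η / 3 * ∫ ω, bfbe M μ (3 * smoothConst M) (Y ω) ∂Pr
        + 2 * smoothConst M * η ^ 2 * σ ^ 2 := by
  let F : posPolicies S A × Ξ → ℝ := fun p => potential M μ η (mwUpdate η (g p.1 p.2) p.1)
  let H : posPolicies S A → ℝ := fun y => potential M μ η y
      - η / 3 * bfbe M μ (3 * smoothConst M) y + 2 * smoothConst M * η ^ 2 * σ ^ 2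
  have : IsProbabilityMeasure (Pr.map Y) := Measure.isProbabilityMeasure_map hY.aemeasurable
  have hF : Integrable F ((Pr.map Y).prod Q) := by
    have h1 : Measurable fun p : posPolicies S A × Ξ => (p.1 : S → A → ℝ) :=
      measurable_subtype_coe.comp measurable_fst
    exact integrable_potential_comp M hμ η ((Pr.map Y).prod Q) ((measurable_mwUpdate η).comp
      ((hg.measurable.comp (h1.prodMk measurable_snd)).prodMk h1)) fun p => mwUpdate_mem p.1.2 η _
  have hH : Integrable H (Pr.map Y) :=
    ((integrable_potential_comp M hμ η _ measurable_subtype_coe fun y => y.2).sub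
      ((integrable_bfbe_comp M hμ _ measurable_subtype_coe fun y => y.2).const_mul _)).add
      (integrable_const _)
  have hFH : ∀ y, ∫ z, F (y, z) ∂Q ≤ H y := fun y => by
    have hy := y.2
    have := integral_potential_mwUpdate_le M hμ hg hη hηl hy
    exact this
  have hYm : Measurable fun ω => (Y ω : S → A → ℝ) := measurable_subtype_coe.comp hY
  have hpot := integrable_potential_comp M hμ η Pr hYm fun ω => (Y ω).2
  have hbf := (integrable_bfbe_comp M hμ Pr hYm fun ω => (Y ω).2).const_mul (η / 3)
  refine (integral_comp_le_of_indepFun hY hζ hlaw hind hF hH hFH).trans_eq ?_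
  have e := integral_add (hpot.sub hbf) (integrable_const (2 * smoothConst M * η ^ 2 * σ ^ 2))
  refine e.trans ?_
  rw [integral_sub' hpot hbf, integral_const_mul]
  simp

variable {π₀ : S → A → ℝ} {ξ : ℕ → Ω → Ξ} {x : ℕ → Ω → S → A → ℝ} {η : ℝ}

omit [DecidableEq S] [DecidableEq A] [IsProbabilityMeasure Q] [IsProbabilityMeasure Pr] in
-- The minimizer of each mirror step is unique and explicit, so by induction the iterate at time `t`
-- is a measurable function of the samples before `t`. This supplies both its measurability and its
-- independence of `ξ t`.
theorem IsRun.exists_eq_comp (hrun : IsRun Q g η π₀ Pr ξ x)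
    (hg : Measurable fun p : (S → A → ℝ) × Ξ => g p.1 p.2)
    (h0 : π₀ ∈ policies S A ∩ zone S A) (t : ℕ) :
    ∃ Φ : (Finset.range t → Ξ) → posPolicies S A, Measurable Φ ∧
      ∀ ω, x t ω = Φ fun i => ξ i ω := by
  induction t with
  | zero => exact ⟨fun _ => ⟨π₀, h0⟩, measurable_const, hrun.init⟩
  | succ t ih =>
    obtain ⟨Φ, hΦ, hx⟩ := ih
    let r : (Finset.range (t + 1) → Ξ) → Finset.range t → Ξ := fun z i =>
      z ⟨i, Finset.mem_range.2 ((Finset.mem_range.1 i.2).trans t.lt_succ_self)⟩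
    have hr : Measurable r := measurable_pi_lambda _ fun i => measurable_pi_apply _
    let last : Finset.range (t + 1) := ⟨t, Finset.self_mem_range_succ t⟩
    have hc : Measurable fun z => (Φ (r z) : S → A → ℝ) :=
      measurable_subtype_coe.comp (hΦ.comp hr)
    refine ⟨fun z => ⟨mwUpdate η (g (Φ (r z)) (z last)) (Φ (r z)),
      mwUpdate_mem (Φ (r z)).2 η _⟩, ?_, fun ω => ?_⟩
    · exact Measurable.subtype_mk ((measurable_mwUpdate η).comp
        ((hg.comp (hc.prodMk (measurable_pi_apply last))).prodMk hc))
    · have h := hrun.step t ω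
      have hmem : x t ω ∈ policies S A ∩ zone S A := by rw [hx]; exact (Φ _).2
      rw [h.eq_mwUpdate hmem, hx]

omit [IsProbabilityMeasure Q] [IsProbabilityMeasure Pr] in
/-- The iterates are measurable positive policies, each independent of the next sample. -/
theorem IsRun.exists_posPolicies (hrun : IsRun Q g η π₀ Pr ξ x) (hg : IsOracle M μ σ Q g)
    (h0 : π₀ ∈ policies S A ∩ zone S A) (t : ℕ) :
    ∃ Y : Ω → posPolicies S A, Measurable Y ∧ (∀ ω, x t ω = Y ω) ∧ IndepFun Y (ξ t) Pr := by
  obtain ⟨Φ, hΦ, hx⟩ := hrun.exists_eq_comp hg.measurable h0 t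
  refine ⟨fun ω => Φ fun i => ξ i ω,
    hΦ.comp (measurable_pi_lambda _ fun i => hrun.measurable i), hx, ?_⟩
  have h := hrun.indep.indepFun_finset (Finset.range t) {t} (by simp) hrun.measurable
  exact h.comp hΦ (measurable_pi_apply (⟨t, Finset.mem_singleton_self t⟩ : ({t} : Finset ℕ)))

theorem IsRun.integrable_bfbe (hrun : IsRun Q g η π₀ Pr ξ x) (hμ : μ ∈ stdSimplex ℝ S)
    (hg : IsOracle M μ σ Q g) (h0 : π₀ ∈ policies S A ∩ zone S A) (t : ℕ) :
    Integrable (fun ω => bfbe M μ (3 * smoothConst M) (x t ω)) Pr := by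
  obtain ⟨Y, hY, hx, -⟩ := hrun.exists_posPolicies M hg h0 t
  simp only [hx]
  exact integrable_bfbe_comp M hμ _ (measurable_subtype_coe.comp hY) fun ω => (Y ω).2

theorem IsRun.integral_potential_succ_le (hrun : IsRun Q g η π₀ Pr ξ x)
    (hμ : μ ∈ stdSimplex ℝ S) (hg : IsOracle M μ σ Q g)
    (h0 : π₀ ∈ policies S A ∩ zone S A) (hη : 0 ≤ η) (hηl : η * smoothConst M ≤ 1 / 2) (t : ℕ) :
    ∫ ω, potential M μ η (x (t + 1) ω) ∂Pr ≤ ∫ ω, potential M μ η (x t ω) ∂Pr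
        - η / 3 * ∫ ω, bfbe M μ (3 * smoothConst M) (x t ω) ∂Pr
        + 2 * smoothConst M * η ^ 2 * σ ^ 2 := by
  obtain ⟨Y, hY, hx, hind⟩ := hrun.exists_posPolicies M hg h0 t
  have hs : ∀ ω, x (t + 1) ω = mwUpdate η (g (Y ω) (ξ t ω)) (Y ω) := fun ω => by
    have h := hrun.step t ω
    rw [hx ω] at h
    exact h.eq_mwUpdate (Y ω).2
  simp only [hs, hx]
  exact integral_potential_step_le M hμ hg hη hηl hY (hrun.measurable t) (hrun.law t) hind

/-- The convergence rate before tuning the step size. -/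
theorem IsRun.sum_integral_bfbe_le (hrun : IsRun Q g η π₀ Pr ξ x)
    (hμ : μ ∈ stdSimplex ℝ S) (hg : IsOracle M μ σ Q g)
    (h0 : π₀ ∈ policies S A ∩ zone S A) (hη : 0 ≤ η) (hηl : η * smoothConst M ≤ 1 / 2) (T : ℕ) :
    η / 3 * ∑ t ∈ Finset.range T, ∫ ω, bfbe M μ (3 * smoothConst M) (x t ω) ∂Pr
      ≤ initGap M μ π₀ + T * (2 * smoothConst M * η ^ 2 * σ ^ 2) := by
  have hl := smoothConst_nonneg M
  have htel : η / 3 * ∑ t ∈ Finset.range T, ∫ ω, bfbe M μ (3 * smoothConst M) (x t ω) ∂Pr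
      ≤ potential M μ η π₀ - ∫ ω, potential M μ η (x T ω) ∂Pr
        + T * (2 * smoothConst M * η ^ 2 * σ ^ 2) := by
    induction T with
    | zero => simp [hrun.init]
    | succ T ih =>
      rw [Finset.sum_range_succ, mul_add]
      have := hrun.integral_potential_succ_le M hμ hg h0 hη hηl T
      push_cast
      linarith
  have hlow : (1 + 2 * smoothConst M * η) * optV M μ ≤ ∫ ω, potential M μ η (x T ω) ∂Pr := by
    obtain ⟨Y, hY, hx, -⟩ := hrun.exists_posPolicies M hg h0 T
    simp only [hx]
    have h := integral_mono (integrable_const (μ := Pr) ((1 + 2 * smoothConst M * η) * optV M μ))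
      (integrable_potential_comp M hμ η Pr (measurable_subtype_coe.comp hY) fun ω => (Y ω).2)
      fun ω => ?_
    · simpa using h
    · have h1 := optV_le_moreauEnv M hμ (ρ := 2 * smoothConst M) (by positivity) (Y ω).2
      have h2 := mul_le_mul_of_nonneg_left (optV_le M hμ (Y ω).2.1)
        (by positivity : 0 ≤ 2 * smoothConst M * η)
      simp only [potential, Function.comp_apply]
      linarith
  have hV := optV_le M hμ h0.1
  -- Here `2ℓη ≤ 1` enters: the weight of the `V` gap in the potential is at most its weight in
  -- `initGap`.
  have hE : potential M μ η π₀ - (1 + 2 * smoothConst M * η) * optV M μ ≤ initGap M μ π₀ := by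
    have := mul_le_mul_of_nonneg_right (by linarith : 2 * smoothConst M * η ≤ 1)
      (sub_nonneg.2 hV)
    unfold potential initGap
    linarith
  linarith

omit [DecidableEq S] [DecidableEq A] in
theorem optV_gap_le_initGap (hμ : μ ∈ stdSimplex ℝ S) (h0 : π₀ ∈ policies S A ∩ zone S A) :
    V M μ π₀ - optV M μ ≤ initGap M μ π₀ := by
  have hl := smoothConst_nonneg M
  have := optV_le_moreauEnv M hμ (ρ := 2 * smoothConst M) (by positivity) h0
  unfold initGap
  linarith

end Stochastic

/-! ### Tuning the step size. -/

/-- The step size balances the two terms of the rate. -/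
theorem stepSize_spec {l d σ ε L : ℝ} {T : ℕ} (hl : 0 < l) (hd : 0 < d) (hσ : 0 ≤ σ)
    (hε : 0 < ε) (hT : 1 ≤ T) (hL : l ≤ 2 * L)
    (hTC : 162 * d * (L / ε ^ 2 + σ ^ 2 * L / ε ^ 4) ≤ T) :
    0 < stepSize l d σ T ∧ stepSize l d σ T * l ≤ 1 / 2 ∧
      d + T * (2 * l * stepSize l d σ T ^ 2 * σ ^ 2) ≤ stepSize l d σ T / 3 * (T * ε ^ 2) := by
  have hT0 : (0 : ℝ) < T := by exact_mod_cast hT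
  have hL0 : 0 < L := by linarith
  have hA : 162 * d * L ≤ T * ε ^ 2 := by
    have h : 162 * d * (L / ε ^ 2) ≤ T := le_trans
      (mul_le_mul_of_nonneg_left (by simp; positivity) (by positivity)) hTC
    rwa [← mul_div_assoc, div_le_iff₀ (by positivity)] at h
  have hB : 162 * d * (σ ^ 2 * L) ≤ T * ε ^ 4 := by
    have h : 162 * d * (σ ^ 2 * L / ε ^ 4) ≤ T := le_trans
      (mul_le_mul_of_nonneg_left (by simp; positivity) (by positivity)) hTC
    rwa [← mul_div_assoc, div_le_iff₀ (by positivity)] at h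
  -- The regime where `1 / (2l)` is the minimum, including `σ = 0`: the noise contributes at most `2
  -- * d`, so `3 * d` has to be beaten.
  have large : ∀ η : ℝ, η = 1 / (2 * l) → σ ^ 2 * T ≤ 4 * l * d →
      0 < η ∧ η * l ≤ 1 / 2 ∧ d + T * (2 * l * η ^ 2 * σ ^ 2) ≤ η / 3 * (T * ε ^ 2) := by
    rintro η rfl h
    refine ⟨by positivity, by field_simp; rfl, ?_⟩
    have e1 : T * (2 * l * (1 / (2 * l)) ^ 2 * σ ^ 2) = σ ^ 2 * T / (2 * l) := by
      field_simp
    have h1 : σ ^ 2 * T / (2 * l) ≤ 2 * d := by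
      rw [div_le_iff₀ (by positivity)]
      linarith
    have h2 : 3 * d ≤ 1 / (2 * l) / 3 * (T * ε ^ 2) := by
      have e2 : 1 / (2 * l) / 3 * (T * ε ^ 2) = T * ε ^ 2 / (6 * l) := by field_simp; norm_num
      rw [e2, le_div_iff₀ (by positivity)]
      nlinarith
    linarith
  rcases eq_or_ne σ 0 with rfl | hσ0
  · exact large _ (by simp [stepSize]) (by simp; positivity)
  have hσp : 0 < σ := lt_of_le_of_ne hσ (Ne.symm hσ0)
  set q := Real.sqrt (d / (σ ^ 2 * l * T))
  have hq : 0 < q := Real.sqrt_pos.2 (by positivity)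
  have hq2 : q ^ 2 * (σ ^ 2 * l * T) = d := by
    rw [Real.sq_sqrt (by positivity), div_mul_cancel₀ _ (by positivity)]
  have hη : stepSize l d σ T = min (1 / (2 * l)) q := by simp [stepSize, hσ0, q]
  rcases le_total (1 / (2 * l)) q with h | h
  · refine large _ (by rw [hη, min_eq_left h]) ?_
    have h1 := mul_le_mul_of_nonneg_right (pow_le_pow_left₀ (by positivity) h 2)
      (by positivity : 0 ≤ σ ^ 2 * l * T)
    rw [hq2] at h1
    have e : (1 / (2 * l)) ^ 2 * (σ ^ 2 * l * T) = σ ^ 2 * T / (4 * l) := by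
      field_simp; norm_num
    rw [e, div_le_iff₀ (by positivity)] at h1
    linarith
  · rw [hη, min_eq_right h]
    refine ⟨hq, ?_, ?_⟩
    · calc q * l ≤ 1 / (2 * l) * l := mul_le_mul_of_nonneg_right h hl.le
        _ = 1 / 2 := by field_simp
    · have e : d + T * (2 * l * q ^ 2 * σ ^ 2) = 3 * d := by
        linear_combination 2 * hq2
      -- In the other regime the noise term equals `2 * d` exactly. Squaring the required bound
      -- gives `81 * d * σ² * l ≤ T * ε⁴`, and `l ≤ 2 * L` turns `81` into the constant `162`.
      have h9 : 9 * d ≤ q * (T * ε ^ 2) := by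
        refine (sq_le_sq₀ (by positivity) (by positivity)).1
          (le_of_mul_le_mul_right ?_ (by positivity : 0 < σ ^ 2 * l))
        have h1 : (q * (T * ε ^ 2)) ^ 2 * (σ ^ 2 * l) = d * (T * ε ^ 4) := by
          linear_combination T * ε ^ 4 * hq2
        rw [h1]
        calc (9 * d) ^ 2 * (σ ^ 2 * l) = d * (81 * d * (σ ^ 2 * l)) := by ring
          _ ≤ d * (81 * d * (σ ^ 2 * (2 * L))) := by gcongr
          _ = d * (162 * d * (σ ^ 2 * L)) := by ring
          _ ≤ _ := mul_le_mul_of_nonneg_left hB hd.le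
      rw [e]
      linarith

end SMPG

/-! ### The convergence theorem. -/

theorem corollary3 :
    ∃ C : ℝ, 0 < C ∧
      ∀ (S A Ξ Ω : Type*) [Fintype S] [Fintype A] [DecidableEq S] [DecidableEq A]
        [MeasurableSpace Ξ] [MeasurableSpace Ω]
        (M : SMPG.DMDP S A) (μ : S → ℝ) (_ : μ ∈ stdSimplex ℝ S)
        (σ : ℝ) (_ : 0 ≤ σ)
        (Q : MeasureTheory.Measure Ξ) [MeasureTheory.IsProbabilityMeasure Q]
        (g : (S → A → ℝ) → Ξ → S → A → ℝ) (_ : SMPG.IsOracle M μ σ Q g)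
        (π₀ : S → A → ℝ) (_ : π₀ ∈ SMPG.policies S A ∩ SMPG.zone S A)
        (ε : ℝ) (_ : 0 < ε) (T : ℕ) (_ : 1 ≤ T)
        (_ : C * SMPG.initGap M μ π₀ *
            (1 / ((1 - M.γ) ^ 3 * ε ^ 2) + σ ^ 2 / ((1 - M.γ) ^ 3 * ε ^ 4)) ≤ (T : ℝ))
        (Pr : MeasureTheory.Measure Ω) [MeasureTheory.IsProbabilityMeasure Pr]
        (ξ : ℕ → Ω → Ξ) (x : ℕ → Ω → S → A → ℝ)
        (_ : SMPG.IsRun Q g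
          (SMPG.stepSize (SMPG.smoothConst M) (SMPG.initGap M μ π₀) σ T) π₀ Pr ξ x),
        (∀ t, MeasureTheory.Integrable
          (fun ω => SMPG.bfbe M μ (6 * M.γ / (1 - M.γ) ^ 3) (x t ω)) Pr) ∧
        ∃ t < T, ∫ ω, SMPG.bfbe M μ (6 * M.γ / (1 - M.γ) ^ 3) (x t ω) ∂Pr ≤ ε ^ 2 := by
  refine ⟨162, by norm_num, ?_⟩
  intro S A Ξ Ω _ _ _ _ _ _ M μ hμ σ hσ Q _ g hg π₀ h0 ε hε T hT hTC Pr _ ξ x hrun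
  have hρ : 6 * M.γ / (1 - M.γ) ^ 3 = 3 * SMPG.smoothConst M := by
    unfold SMPG.smoothConst; ring
  rw [hρ]
  refine ⟨hrun.integrable_bfbe M hμ hg h0, ?_⟩
  have h1 : (0 : ℝ) < 1 - M.γ := by linarith [M.γ_lt_one]
  have hl := SMPG.smoothConst_nonneg M
  have hV := SMPG.optV_le M hμ h0.1
  have hgap := SMPG.optV_gap_le_initGap M hμ h0
  -- If `ℓ` or the initial gap vanishes the step size may be zero, but then `bfbe` at `π₀` is
  -- already at most `6ℓ` times the gap, hence nonpositive, and `t = 0` works.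
  by_cases htriv : SMPG.smoothConst M * SMPG.initGap M μ π₀ = 0
  · refine ⟨0, hT, ?_⟩
    have h2 := SMPG.bfbe_le_optV_gap M hμ h0
    have h3 := mul_le_mul_of_nonneg_left hgap hl
    simp only [hrun.init, integral_const, probReal_univ, one_smul]
    nlinarith [sq_nonneg ε]
  have hl' : 0 < SMPG.smoothConst M := lt_of_le_of_ne hl fun h => htriv (by rw [← h, zero_mul])
  have hd : 0 < SMPG.initGap M μ π₀ :=
    lt_of_le_of_ne (by linarith) fun h => htriv (by rw [← h, mul_zero])
  obtain ⟨hη, hηl, hbound⟩ := SMPG.stepSize_spec (L := 1 / (1 - M.γ) ^ 3) hl' hd hσ hε hT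
    (by
      unfold SMPG.smoothConst
      rw [← mul_div_assoc, mul_one]
      exact div_le_div_of_nonneg_right (by linarith [M.γ_lt_one]) (by positivity))
    (by
      refine le_trans (le_of_eq ?_) hTC
      congr 1
      field_simp)
  -- If every expectation exceeded `ε²`, so would their average, against the summed descent bound.
  by_contra! hcon
  have hsum := hrun.sum_integral_bfbe_le M hμ hg h0 hη.le hηl T
  have hlt : (T : ℝ) * ε ^ 2
      < ∑ t ∈ Finset.range T, ∫ ω, SMPG.bfbe M μ (3 * SMPG.smoothConst M) (x t ω) ∂Pr := by
    have := Finset.sum_lt_sum_of_nonempty (s := Finset.range T) (f := fun _ => ε ^ 2)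
      (Finset.nonempty_range_iff.2 (by omega)) fun t ht => hcon t (Finset.mem_range.1 ht)
    simpa using this
  have := mul_lt_mul_of_pos_left hlt (by positivity : 0 < SMPG.stepSize (SMPG.smoothConst M)
    (SMPG.initGap M μ π₀) σ T / 3)
  linarith
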